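/- Let $k$ be an algebraically closed field of characteristic $p>0$ and let $r\ge 1$. Write $k[\mathbb G_a]=k[T]$ and $k[\mathbb G_{a(r)}]=k[T]/(T^{p^r})$, with $T$ primitive, for the coordinate algebras of the additive group and of its $r$-th Frobenius kernel. Let $u_s$ be the functional reading off the coefficient of $T^{p^s}$. A functional $\varphi$ on $k[T]$ acts on a rational $\mathbb G_a$-module $M$ with coaction $\Delta_M:M\to M\otimes k[T]$ by $m\mapsto(\mathrm{id}\otimes\varphi)(\Delta_M(m))$. For a finite sequence $\underline a=(a_0,a_1,\dots)\in\mathbb A^\infty$, let $\sigma_{\underline a}:\mathbb G_a\to\mathbb G_a$ be the 1-parameter subgroup with $\sigma_{\underline a}^*(T)=\sum_s a_sT^{p^s}$. For $\underline b=(b_0,\dots,b_{r-1})\in k^r$, let $\sigma_{\underline b}:\mathbb G_{a(r)}\to\mathbb G_a$ be given by $T\mapsto\sum_{s<r}b_sT^{p^s}$. These are all the homomorphisms of group schemes $\mathbb G_a\to\mathbb G_a$ and $\mathbb G_{a(r)}\to\mathbb G_a$, respectively; write $V_r(\mathbb G_a)$ for the set of the latter. Put $\lambda_r(\underline a)=(a_{r-1},\dots,a_0)$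 and $q_{r+c,r}(\sigma_{(a_0,\dots,a_{r+c-1})})=\sigma_{(a_c,\dots,a_{r+c-1})}$. For a finite dimensional rational $\mathbb G_a$-module $M$, let $JT_{\mathbb G_a,M}(\sigma_{\underline a})$ be the Jordan type of the operator $\sum_s(\sigma_{a_s})_*(u_s)=\sum_s a_s^{p^s}u_s$ on $M$. Let $JT_{\mathbb G_{a(r)},M}(\mu)$ be the Jordan type of the operator $\mu_*(u_{r-1})=u_{r-1}\circ\mu^*$ on $M$. Let $V_r(\mathbb G_a)_M\subseteq V_r(\mathbb G_a)$ be the set of those $\mu$ for which $M$, with $u$ acting as $\mu_*(u_{r-1})$, is not free over $k[u]/(u^p)$. A Jordan type $\sum_i c_i[i]$ means $c_i$ blocks of size $i$. Jordan types of endomorphisms of $M$ are ordered by dominance: $\sum_i c_i[i]\le\sum_i d_i[i]$ if and only if $\sum_{i\ge j}(i-j)c_i\le\sum_{i\ge j}(i-j)d_i$ for all $j$. **Theorem.** Let $M$ be a finite dimensional rational $\mathbb G_a$-module of degree $<p^r$, i.e. $\Delta_M(M)\subseteq M\otimes k[T]_{<p^r}$. Let $\underline b\in k^r$ be such that $JT_{\mathbb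 G_{a(r)},M}(\sigma_{\underline b})$ is maximal among the Jordan types $JT_{\mathbb G_{a(r)},M}(\mu)$, $\mu\in V_r(\mathbb G_a)$ (no such type is strictly larger; in particular this holds if it is greater than or equal to all of them). 1. For every $\underline a\in\mathbb A^\infty$ with $\lambda_r(\underline a)=\underline b$, one has $JT_{\mathbb G_a,M}(\sigma_{\underline a})=JT_{\mathbb G_{a(r)},M}(\sigma_{\underline b})$. 2. $JT_{\mathbb G_{a(r)},M}(\sigma_{\underline b})$ is the maximum of the Jordan types $JT_{\mathbb G_a,M}(\sigma_{\underline a})$, $\underline a\in\mathbb A^\infty$: it is one of them, and every one of them is less than or equal to it. 3. For every $c\ge 0$, $V_{r+c}(\mathbb G_a)_M=q_{r+c,r}^{-1}(V_r(\mathbb G_a)_M)$. -/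

import Mathlib

open Polynomial TensorProduct

universe u v

/-! ## The additive group and its Frobenius kernels -/

section AdditiveGroup

variable {k : Type u} [Field k]

/-- The coordinate algebra `k[𝔾ₐ] = k[T]` of the additive group: the Hopf algebra structure on the
polynomial ring in which `T` is primitive. -/
noncomputable instance gaBialgebra : Bialgebra k k[X] :=
  Bialgebra.ofAlgHom
    (aeval ((X : k[X]) ⊗ₜ[k] (1 : k[X]) + (1 : k[X]) ⊗ₜ[k] (X : k[X])))
    (aeval (0 : k))
    (by
      ext
      simp [Algebra.TensorProduct.one_def, TensorProduct.add_tmul, TensorProduct.tmul_add]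
      abel)
    (by ext; simp)
    (by ext; simp)

theorem ga_comul_X :
    Coalgebra.comul (R := k) (X : k[X]) = X ⊗ₜ[k] (1 : k[X]) + (1 : k[X]) ⊗ₜ[k] X :=
  aeval_X (R := k) _

theorem ga_counit_X : Coalgebra.counit (R := k) (X : k[X]) = 0 :=
  aeval_X (R := k) _

/-- The coordinate algebra `k[𝔾ₐ₍ᵣ₎] = k[T]/(T^(p^r))` of the `r`-th Frobenius kernel. -/
abbrev FrobKerRing (k : Type u) [Field k] (p r : ℕ) : Type u :=
  AdjoinRoot ((X : k[X]) ^ p ^ r)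

/-- The class of `T` in `k[𝔾ₐ₍ᵣ₎]`. -/
noncomputable abbrev frobKerT (k : Type u) [Field k] (p r : ℕ) : FrobKerRing k p r :=
  AdjoinRoot.root ((X : k[X]) ^ p ^ r)

theorem frobKerT_pow (p r : ℕ) : frobKerT k p r ^ p ^ r = 0 := by
  have h : AdjoinRoot.mk ((X : k[X]) ^ p ^ r) (X ^ p ^ r) = 0 := AdjoinRoot.mk_self
  rwa [map_pow, AdjoinRoot.mk_X] at h

theorem add_pow_primePow {A : Type*} [CommRing A] [Algebra k A] (p r : ℕ) [Fact p.Prime]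
    [CharP k p] (x y : A) : (x + y) ^ p ^ r = x ^ p ^ r + y ^ p ^ r := by
  rcases subsingleton_or_nontrivial A with h | h
  · exact Subsingleton.elim _ _
  · have : CharP A p := charP_of_injective_algebraMap (algebraMap k A).injective p
    exact add_pow_char_pow x y p r

theorem frobKer_comul_aux (p r : ℕ) [Fact p.Prime] [CharP k p] :
    eval₂ (Algebra.ofId k (FrobKerRing k p r ⊗[k] FrobKerRing k p r) : k →+* _)
      (frobKerT k p r ⊗ₜ[k] (1 : FrobKerRing k p r) +
        (1 : FrobKerRing k p r) ⊗ₜ[k] frobKerT k p r) ((X : k[X]) ^ p ^ r) = 0 := by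
  simp only [eval₂_X_pow]
  rw [add_pow_primePow (k := k)]
  simp only [Algebra.TensorProduct.tmul_pow, frobKerT_pow, TensorProduct.zero_tmul,
    TensorProduct.tmul_zero, add_zero]

theorem frobKer_counit_aux (p r : ℕ) [hp : Fact p.Prime] :
    eval₂ (Algebra.ofId k k : k →+* k) 0 ((X : k[X]) ^ p ^ r) = 0 := by
  simp [hp.out.ne_zero]

/-- `𝔾ₐ₍ᵣ₎` is a group scheme: the class of `T` is primitive. -/
noncomputable instance frobKerBialgebra (p r : ℕ) [Fact p.Prime] [CharP k p] :
    Bialgebra k (FrobKerRing k p r) :=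
  Bialgebra.ofAlgHom
    (AdjoinRoot.liftAlgHom _ (Algebra.ofId k _)
      (frobKerT k p r ⊗ₜ[k] (1 : FrobKerRing k p r) +
        (1 : FrobKerRing k p r) ⊗ₜ[k] frobKerT k p r)
      (frobKer_comul_aux p r))
    (AdjoinRoot.liftAlgHom _ (Algebra.ofId k k) 0 (frobKer_counit_aux p r))
    (by
      ext
      simp [Algebra.TensorProduct.one_def, TensorProduct.add_tmul, TensorProduct.tmul_add]
      abel)
    (by ext; simp)
    (by ext; simp)

theorem frobKer_comul_T (p r : ℕ) [Fact p.Prime] [CharP k p] :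
    Coalgebra.comul (R := k) (frobKerT k p r) =
      frobKerT k p r ⊗ₜ[k] (1 : FrobKerRing k p r) +
        (1 : FrobKerRing k p r) ⊗ₜ[k] frobKerT k p r :=
  AdjoinRoot.liftAlgHom_root _ _ _ (frobKer_comul_aux p r)

theorem frobKer_counit_T (p r : ℕ) [Fact p.Prime] [CharP k p] :
    Coalgebra.counit (R := k) (frobKerT k p r) = 0 :=
  AdjoinRoot.liftAlgHom_root _ _ _ (frobKer_counit_aux p r)

/-! ## One-parameter subgroups -/

/-- `V(𝔾ₐ)`: homomorphisms of group schemes `𝔾ₐ → 𝔾ₐ`, given on coordinate algebras. -/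
abbrev OneParam (k : Type u) [Field k] : Type u := k[X] →ₐc[k] k[X]

/-- `V_r(𝔾ₐ)(k)`: homomorphisms of group schemes `𝔾ₐ₍ᵣ₎ → 𝔾ₐ`, given on coordinate algebras. -/
abbrev InfOneParam (k : Type u) [Field k] (p r : ℕ) [Fact p.Prime] [CharP k p] : Type u :=
  k[X] →ₐc[k] FrobKerRing k p r

section PrimitiveElements

variable {B : Type u} [CommRing B] [Bialgebra k B]

/-- The homomorphism of bialgebras `k[T] → B` with `T ↦ t`, for `t` primitive. -/
noncomputable def primitiveHom (t : B)
    (h : Coalgebra.comul (R := k) t = t ⊗ₜ[k] (1 : B) + (1 : B) ⊗ₜ[k] t)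
    (h0 : Coalgebra.counit (R := k) t = 0) : k[X] →ₐc[k] B :=
  BialgHom.ofAlgHom (aeval t) (by ext; simp [h0, ga_counit_X]) (by ext; simp [h, ga_comul_X])

theorem primitiveHom_X (t : B) (h h0) : primitiveHom (k := k) t h h0 X = t :=
  aeval_X (R := k) t

theorem gaHom_ext {f g : k[X] →ₐc[k] B} (h : f X = g X) : f = g := by
  have : (f : k[X] →ₐ[k] B) = g := by ext; exact h
  exact DFunLike.ext _ _ fun x => DFunLike.congr_fun this x

theorem gaHom_comul_X (f : k[X] →ₐc[k] B) :
    Coalgebra.comul (R := k) (f X) = f X ⊗ₜ[k] (1 : B) + (1 : B) ⊗ₜ[k] f X := by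
  rw [← CoalgHomClass.map_comp_comul_apply, ga_comul_X]
  simp

theorem comul_sum_pow (p : ℕ) [Fact p.Prime] [CharP k p] {ι : Type*} (S : Finset ι) (c : ι → k)
    (e : ι → ℕ) (t : B)
    (h : Coalgebra.comul (R := k) t = t ⊗ₜ[k] (1 : B) + (1 : B) ⊗ₜ[k] t) :
    Coalgebra.comul (R := k) (∑ s ∈ S, c s • t ^ p ^ e s) =
      (∑ s ∈ S, c s • t ^ p ^ e s) ⊗ₜ[k] (1 : B) +
        (1 : B) ⊗ₜ[k] (∑ s ∈ S, c s • t ^ p ^ e s) := by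
  simp only [map_sum, map_smul, Bialgebra.comul_pow, h, add_pow_primePow (k := k),
    Algebra.TensorProduct.tmul_pow, one_pow, TensorProduct.sum_tmul, TensorProduct.tmul_sum,
    TensorProduct.smul_tmul', TensorProduct.tmul_smul, smul_add, Finset.sum_add_distrib]

theorem counit_sum_pow (p : ℕ) [hp : Fact p.Prime] {ι : Type*} (S : Finset ι) (c : ι → k)
    (e : ι → ℕ) (t : B) (h0 : Coalgebra.counit (R := k) t = 0) :
    Coalgebra.counit (R := k) (∑ s ∈ S, c s • t ^ p ^ e s) = 0 := by
  simp [h0, hp.out.ne_zero]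

end PrimitiveElements

/-- The 1-parameter subgroup `σ_a = ∑ a_s F^s` of `𝔾ₐ`, that is `T ↦ ∑ a_s T^(p^s)`. -/
noncomputable def sigma (p : ℕ) [Fact p.Prime] [CharP k p] (a : ℕ →₀ k) : OneParam k :=
  primitiveHom (∑ s ∈ a.support, a s • (X : k[X]) ^ p ^ s)
    (comul_sum_pow p a.support a id X ga_comul_X) (counit_sum_pow p a.support a id X ga_counit_X)

/-- The infinitesimal 1-parameter subgroup `σ_b : 𝔾ₐ₍ᵣ₎ → 𝔾ₐ`, that is `T ↦ ∑ b_s T^(p^s)`. -/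
noncomputable def infSigma (p : ℕ) {r : ℕ} [Fact p.Prime] [CharP k p] (b : Fin r → k) :
    InfOneParam k p r :=
  primitiveHom (∑ s : Fin r, b s • frobKerT k p r ^ p ^ (s : ℕ))
    (comul_sum_pow p Finset.univ b (fun s => (s : ℕ)) _ (frobKer_comul_T p r))
    (counit_sum_pow p Finset.univ b (fun s => (s : ℕ)) _ (frobKer_counit_T p r))

/-- If `p` divides `n.choose i` for all `0 < i < n`, then `n ≥ 1` is a power of `p`. -/
theorem eq_primePow_of_choose (p : ℕ) [hp : Fact p.Prime] (n : ℕ) (hn : n ≠ 0)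
    (h : ∀ i, 0 < i → i < n → p ∣ n.choose i) : ∃ s, n = p ^ s := by
  obtain ⟨v, m, hm, rfl⟩ := Nat.exists_eq_pow_mul_and_not_dvd hn p hp.out.ne_one
  refine ⟨v, ?_⟩
  have key : ∀ v : ℕ, (p ^ v * m).choose (p ^ v) ≡ m [MOD p] := by
    intro v
    induction v with
    | zero => simp [Nat.ModEq]
    | succ v ih =>
      have := Choose.choose_modEq_choose_mod_mul_choose_div_nat (p := p)
        (n := p ^ (v + 1) * m) (k := p ^ (v + 1))
      rw [pow_succ', mul_assoc, Nat.mul_mod_right, Nat.mul_mod_right,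
        Nat.mul_div_cancel_left _ hp.out.pos, Nat.mul_div_cancel_left _ hp.out.pos] at this
      rw [pow_succ', mul_assoc]
      simp only [Nat.choose_self, one_mul] at this
      exact this.trans ih
  by_contra hne
  have hm0 : m ≠ 0 := by rintro rfl; simp at hm
  have hpv : 0 < p ^ v := pow_pos hp.out.pos v
  have hm1 : 1 < m := by
    rcases Nat.lt_or_ge 1 m with h | h
    · exact h
    · interval_cases m <;> simp_all
  have hd := h (p ^ v) hpv (by nlinarith)
  exact hm ((key v).dvd_iff dvd_rfl |>.1 hd)

/-- Reading off the coefficient of `T^i ⊗ T^j`. -/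
noncomputable def coeffTwo (i j : ℕ) : k[X] ⊗[k] k[X] →ₗ[k] k :=
  (TensorProduct.lid k k).toLinearMap ∘ₗ TensorProduct.map (lcoeff k i) (lcoeff k j)

theorem coeffTwo_comul (i j : ℕ) (f : k[X]) :
    coeffTwo i j (Coalgebra.comul (R := k) f) = ((i + j).choose i : k) * f.coeff (i + j) := by
  induction f using Polynomial.induction_on' with
  | add f g hf hg => simp [hf, hg, mul_add]
  | monomial n c =>
    rw [← C_mul_X_pow_eq_monomial, ← smul_eq_C_mul, map_smul, Bialgebra.comul_pow, ga_comul_X,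
      add_pow]
    simp only [Algebra.TensorProduct.tmul_pow, one_pow, Algebra.TensorProduct.tmul_mul_tmul,
      one_mul, mul_one, map_smul, map_sum]
    have : ∀ m ∈ Finset.range (n + 1), coeffTwo (k := k) i j
        (((X : k[X]) ^ m) ⊗ₜ[k] ((X : k[X]) ^ (n - m)) * ((n.choose m : ℕ) : k[X] ⊗[k] k[X])) =
        if m = i then (if n = i + j then ((i + j).choose i : k) else 0) else 0 := by
      intro m hm
      rw [mul_comm, ← nsmul_eq_mul, map_nsmul]
      simp only [coeffTwo, LinearMap.comp_apply, TensorProduct.map_tmul, lcoeff_apply, coeff_X_pow,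
        LinearEquiv.coe_coe, TensorProduct.lid_tmul, smul_eq_mul, nsmul_eq_mul]
      have hm' : m ≤ n := by simpa [Nat.lt_succ_iff] using hm
      rcases eq_or_ne m i with rfl | hmi
      · rcases eq_or_ne n (m + j) with rfl | hne
        · simp
        · have : j ≠ n - m := by omega
          simp [hne, this]
      · simp [hmi, Ne.symm hmi]
    rw [Finset.sum_congr rfl this]
    simp only [Finset.sum_ite_eq', Finset.mem_range, coeff_smul, coeff_X_pow, smul_eq_mul]
    rcases eq_or_ne n (i + j) with rfl | hne
    · simp [mul_comm]
    · simp [hne, Ne.symm hne]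

/-- The coefficients of an additive polynomial away from the powers of `p` vanish. -/
theorem coeff_eq_zero_of_choose (p : ℕ) [Fact p.Prime] [CharP k p] (f : k[X]) (n : ℕ)
    (h : ∀ i j, 0 < i → 0 < j → i + j = n → ((i + j).choose i : k) * f.coeff (i + j) = 0)
    (h0 : n = 0 → f.coeff 0 = 0) (hn : ∀ s, n ≠ p ^ s) : f.coeff n = 0 := by
  by_contra hf
  by_cases hn0 : n = 0
  · subst hn0; exact hf (h0 rfl)
  · obtain ⟨s, hs⟩ := eq_primePow_of_choose p n hn0 (fun i hi hin => by
      have := h i (n - i) hi (by omega) (by omega)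
      rw [show i + (n - i) = n by omega] at this
      rcases mul_eq_zero.1 this with h | h
      · exact (CharP.cast_eq_zero_iff k p _).1 h
      · exact absurd h hf)
    exact hn s hs

theorem coeff_of_primitive (p : ℕ) [Fact p.Prime] [CharP k p] (f : k[X])
    (h : Coalgebra.comul (R := k) f = f ⊗ₜ[k] (1 : k[X]) + (1 : k[X]) ⊗ₜ[k] f) (n : ℕ)
    (hn : ∀ s, n ≠ p ^ s) : f.coeff n = 0 := by
  have key : ∀ i j, ((i + j).choose i : k) * f.coeff (i + j) =
      f.coeff i * (1 : k[X]).coeff j + (1 : k[X]).coeff i * f.coeff j := by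
    intro i j
    rw [← coeffTwo_comul, h]
    simp [coeffTwo]
  refine coeff_eq_zero_of_choose p f n (fun i j hi hj _ => ?_) (fun _ => ?_) hn
  · rw [key]; simp [coeff_one, hi.ne', hj.ne']
  · simpa using key 0 0

/-- The functional on `k[𝔾ₐ₍ᵣ₎]` reading off the coefficient of `T^i` (for `i < p^r`). -/
noncomputable def frobCoeff (p r i : ℕ) : FrobKerRing k p r →ₗ[k] k :=
  lcoeff k i ∘ₗ AdjoinRoot.modByMonicHom (monic_X_pow (p ^ r))

theorem frobCoeff_mk (p r i : ℕ) (hi : i < p ^ r) (f : k[X]) :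
    frobCoeff p r i (AdjoinRoot.mk _ f) = f.coeff i := by
  have h := modByMonic_add_div f ((X : k[X]) ^ p ^ r)
  rw [frobCoeff, LinearMap.comp_apply, AdjoinRoot.modByMonicHom_mk, lcoeff_apply]
  conv_rhs => rw [← h]
  rw [coeff_add, coeff_X_pow_mul', if_neg (by omega), add_zero]

/-- Restriction of functions along the inclusion `𝔾ₐ₍ᵣ₎ ⊂ 𝔾ₐ`. -/
noncomputable def frobRestrict (k : Type u) [Field k] (p r : ℕ) : k[X] →ₐ[k] FrobKerRing k p r :=
  aeval (frobKerT k p r)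

theorem frobRestrict_apply (p r : ℕ) (f : k[X]) :
    frobRestrict k p r f = AdjoinRoot.mk ((X : k[X]) ^ p ^ r) f :=
  AdjoinRoot.aeval_eq f

theorem frobKer_comul_mk (p r : ℕ) [Fact p.Prime] [CharP k p] (f : k[X]) :
    Coalgebra.comul (R := k) (AdjoinRoot.mk ((X : k[X]) ^ p ^ r) f) =
      Algebra.TensorProduct.map (frobRestrict k p r) (frobRestrict k p r) (Coalgebra.comul (R := k) f) := by
  have : (Bialgebra.comulAlgHom k (FrobKerRing k p r)).comp (frobRestrict k p r) =
      (Algebra.TensorProduct.map (frobRestrict k p r) (frobRestrict k p r)).comp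
        (Bialgebra.comulAlgHom k k[X]) := by
    ext
    simp only [frobRestrict, AlgHom.comp_apply, aeval_X, Bialgebra.comulAlgHom_apply,
      frobKer_comul_T, ga_comul_X, map_add, Algebra.TensorProduct.map_tmul, map_one]
  have h := DFunLike.congr_fun this f
  simpa only [AlgHom.comp_apply, frobRestrict_apply, Bialgebra.comulAlgHom_apply] using h

theorem frob_coeff_of_primitive (p r : ℕ) [hp : Fact p.Prime] [CharP k p] (t : FrobKerRing k p r)
    (h : Coalgebra.comul (R := k) t = t ⊗ₜ[k] (1 : FrobKerRing k p r) + 1 ⊗ₜ[k] t) (n : ℕ)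
    (hnr : n < p ^ r) (hn : ∀ s, n ≠ p ^ s) : frobCoeff p r n t = 0 := by
  obtain ⟨f, rfl⟩ := AdjoinRoot.mk_surjective t
  rw [frobCoeff_mk _ _ _ hnr]
  have key : ∀ i j, i + j < p ^ r → ((i + j).choose i : k) * f.coeff (i + j) =
      f.coeff i * (1 : k[X]).coeff j + (1 : k[X]).coeff i * f.coeff j := by
    intro i j hij
    have hi : i < p ^ r := by omega
    have hj : j < p ^ r := by omega
    let E : FrobKerRing k p r ⊗[k] FrobKerRing k p r →ₗ[k] k :=
      (TensorProduct.lid k k).toLinearMap ∘ₗ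
        TensorProduct.map (frobCoeff p r i) (frobCoeff p r j)
    have hE : ∀ w, E (Algebra.TensorProduct.map (frobRestrict k p r) (frobRestrict k p r) w) = coeffTwo i j w := by
      intro w
      induction w with
      | zero => simp
      | add x y hx hy => simp only [map_add, hx, hy]
      | tmul x y =>
        simp only [E, coeffTwo, Algebra.TensorProduct.map_tmul, LinearMap.comp_apply,
          TensorProduct.map_tmul, frobRestrict_apply, frobCoeff_mk _ _ _ hi,
          frobCoeff_mk _ _ _ hj, lcoeff_apply]
    have h1 := congrArg E h
    rw [frobKer_comul_mk, hE, coeffTwo_comul] at h1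
    rw [h1, ← map_one (AdjoinRoot.mk ((X : k[X]) ^ p ^ r))]
    simp only [E, map_add, LinearMap.comp_apply, TensorProduct.map_tmul, LinearEquiv.coe_coe,
      TensorProduct.lid_tmul, frobCoeff_mk _ _ _ hi, frobCoeff_mk _ _ _ hj, smul_eq_mul]
  refine coeff_eq_zero_of_choose p f n (fun i j hi hj hij => ?_) (fun h0 => ?_) hn
  · rw [key i j (by omega)]; simp [coeff_one, hi.ne', hj.ne']
  · simpa using key 0 0 (by omega)

/-- The coordinates of a 1-parameter subgroup of `𝔾ₐ`: the coefficients of `ψ^*(T)` at `T^(p^s)`. -/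
noncomputable def oneParamCoord (p : ℕ) [hp : Fact p.Prime] (ψ : OneParam k) : ℕ →₀ k :=
  Finsupp.onFinset (Finset.range ((ψ X).natDegree + 1)) (fun s => (ψ X).coeff (p ^ s))
    (fun _ hs => Finset.mem_range.2 (lt_of_lt_of_le (Nat.lt_pow_self hp.out.one_lt)
      ((le_natDegree_of_ne_zero hs).trans (Nat.le_succ _))))

theorem oneParamCoord_apply (p : ℕ) [Fact p.Prime] (ψ : OneParam k) (s : ℕ) :
    oneParamCoord p ψ s = (ψ X).coeff (p ^ s) := rfl

/-- `a ↦ σ_a` is a bijection of `𝔸^∞` with the set `V(𝔾ₐ)` of 1-parameter subgroups of `𝔾ₐ`. -/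
noncomputable def oneParamEquiv (k : Type u) [Field k] (p : ℕ) [hp : Fact p.Prime] [CharP k p] :
    (ℕ →₀ k) ≃ OneParam k where
  toFun := sigma p
  invFun := oneParamCoord p
  left_inv a := by
    ext s
    rw [oneParamCoord_apply, sigma, primitiveHom_X]
    simp only [finsetSum_coeff, coeff_smul, coeff_X_pow,
      (Nat.pow_right_injective hp.out.two_le).eq_iff, smul_eq_mul, mul_ite, mul_one, mul_zero,
      Finset.sum_ite_eq]
    split_ifs with h
    · rfl
    · exact (Finsupp.notMem_support_iff.1 h).symm
  right_inv ψ := by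
    apply gaHom_ext
    rw [sigma, primitiveHom_X]
    ext n
    simp only [finsetSum_coeff, coeff_smul, coeff_X_pow, smul_eq_mul, mul_ite, mul_one, mul_zero]
    by_cases hn : ∃ s, n = p ^ s
    · obtain ⟨s, rfl⟩ := hn
      simp only [(Nat.pow_right_injective hp.out.two_le).eq_iff, Finset.sum_ite_eq]
      split_ifs with h
      · rfl
      · exact (Finsupp.notMem_support_iff.1 h).symm
    · push Not at hn
      rw [coeff_of_primitive p (ψ X) (gaHom_comul_X ψ) n hn]
      exact Finset.sum_eq_zero fun s _ => if_neg (hn s)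

/-- `b ↦ σ_b` is a bijection of `k^r` with the set `V_r(𝔾ₐ)(k)` of infinitesimal 1-parameter
subgroups. -/
noncomputable def infOneParamEquiv (k : Type u) [Field k] (p r : ℕ) [hp : Fact p.Prime]
    [CharP k p] : (Fin r → k) ≃ InfOneParam k p r where
  toFun := infSigma p
  invFun μ := fun s => frobCoeff p r (p ^ (s : ℕ)) (μ X)
  left_inv b := by
    funext s
    have hs : ∀ s : Fin r, p ^ (s : ℕ) < p ^ r := fun s => Nat.pow_lt_pow_right hp.out.one_lt s.2
    simp only [infSigma]
    rw [primitiveHom_X]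
    simp only [map_sum, map_smul, frobKerT, ← AdjoinRoot.mk_X, ← map_pow, frobCoeff_mk _ _ _ (hs s),
      coeff_X_pow, (Nat.pow_right_injective hp.out.two_le).eq_iff, smul_eq_mul, mul_ite, mul_one,
      mul_zero, Fin.val_inj, Finset.sum_ite_eq, Finset.mem_univ, if_true]
  right_inv μ := by
    apply gaHom_ext
    rw [infSigma, primitiveHom_X]
    have hs : ∀ s : Fin r, p ^ (s : ℕ) < p ^ r := fun s => Nat.pow_lt_pow_right hp.out.one_lt s.2
    have hprim := frob_coeff_of_primitive p r (μ X) (gaHom_comul_X μ)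
    obtain ⟨f, hf⟩ := AdjoinRoot.mk_surjective (μ X)
    rw [← hf] at hprim
    dsimp only
    rw [← hf]
    have hsum : ∑ s : Fin r, frobCoeff p r (p ^ (s : ℕ)) (AdjoinRoot.mk ((X : k[X]) ^ p ^ r) f) •
        frobKerT k p r ^ p ^ (s : ℕ) = AdjoinRoot.mk ((X : k[X]) ^ p ^ r)
          (∑ s : Fin r, f.coeff (p ^ (s : ℕ)) • X ^ p ^ (s : ℕ)) := by
      rw [map_sum]
      refine Finset.sum_congr rfl fun s _ => ?_
      rw [frobCoeff_mk _ _ _ (hs s), ← frobRestrict_apply, map_smul, frobRestrict, map_pow, aeval_X]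
    rw [hsum, AdjoinRoot.mk_eq_mk, X_pow_dvd_iff]
    intro n hnr
    simp only [coeff_sub, finsetSum_coeff, coeff_smul, coeff_X_pow, smul_eq_mul, mul_ite, mul_one,
      mul_zero]
    by_cases hn : ∃ s, n = p ^ s
    · obtain ⟨s, rfl⟩ := hn
      have hsr : s < r := (Nat.pow_lt_pow_iff_right hp.out.one_lt).1 hnr
      simp only [(Nat.pow_right_injective hp.out.two_le).eq_iff]
      rw [Finset.sum_eq_single (⟨s, hsr⟩ : Fin r)]
      · simp
      · intro t _ ht
        exact if_neg fun h => ht (Fin.ext h.symm)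
      · simp
    · push Not at hn
      have := hprim n hnr hn
      rw [frobCoeff_mk _ _ _ hnr] at this
      rw [this, sub_zero]
      exact Finset.sum_eq_zero fun s _ => if_neg (hn s)

end AdditiveGroup

/-! ## Jordan types -/

section JordanType

variable {k : Type u} [Field k] {V : Type v} [AddCommGroup V] [Module k V]

/-- `φ` has Jordan type `∑ c_i [i]`: in some basis `φ` is a direct sum of nilpotent Jordan blocks,
with `c_i` blocks of size `i` for each `i ≥ 1`. The basis vector `⟨i, l, j⟩` is the `j`-th vector of
the `l`-th block of size `i`. -/
def HasJordanType (φ : Module.End k V) (c : ℕ → ℕ) : Prop :=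
  c 0 = 0 ∧ ∃ b : Module.Basis (Σ i : ℕ, Fin (c i) × Fin i) k V,
    ∀ (i : ℕ) (l : Fin (c i)) (j : Fin i),
      φ (b ⟨i, l, j⟩) = if h : (j : ℕ) + 1 < i then b ⟨i, l, ⟨(j : ℕ) + 1, h⟩⟩ else 0

open Classical in
/-- The Jordan type of a nilpotent endomorphism `φ` of a finite dimensional space, as the function
sending `i` to the number of Jordan blocks of size `i`. -/
noncomputable def jordanType (φ : Module.End k V) : ℕ → ℕ :=
  if h : ∃ c, HasJordanType φ c then h.choose else 0

theorem exists_basis_quotient_X_pow (n : ℕ) :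
    ∃ b : Module.Basis (Fin n) k (k[X] ⧸ (Submodule.span k[X] {(X : k[X]) ^ n})),
      ∀ j : Fin n, (X : k[X]) • b j = if h : (j : ℕ) + 1 < n then b ⟨(j : ℕ) + 1, h⟩ else 0 := by
  let b0 := (AdjoinRoot.powerBasis' (monic_X_pow (R := k) n)).basis.reindex
    (finCongr (natDegree_X_pow n))
  have hb0 : ∀ j : Fin n, b0 j = AdjoinRoot.mk ((X : k[X]) ^ n) (X ^ (j : ℕ)) := by
    intro j
    simp only [b0, Module.Basis.reindex_apply, PowerBasis.coe_basis, AdjoinRoot.powerBasis'_gen,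
      map_pow, AdjoinRoot.mk_X]
    rfl
  have key : ∀ j : Fin n, AdjoinRoot.mk ((X : k[X]) ^ n) (X * X ^ (j : ℕ)) =
      if h : (j : ℕ) + 1 < n then b0 ⟨(j : ℕ) + 1, h⟩ else 0 := by
    intro j
    split_ifs with h
    · rw [hb0, pow_succ']
    · rw [← pow_succ', show (j : ℕ) + 1 = n by omega]
      exact AdjoinRoot.mk_self
  let b1 : Module.Basis (Fin n) k (k[X] ⧸ (Submodule.span k[X] {(X : k[X]) ^ n})) := b0
  have hb1 : ∀ j : Fin n, b1 j = Submodule.Quotient.mk (X ^ (j : ℕ)) := hb0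
  refine ⟨b1, fun j => ?_⟩
  have h1 : (X : k[X]) • b1 j = Submodule.Quotient.mk (X * X ^ (j : ℕ)) := by
    rw [hb1 j]; rfl
  exact h1.trans (key j)

theorem dfinsupp_basis_apply {ι : Type*} [DecidableEq ι] {N : ι → Type*}
    [∀ i, AddCommGroup (N i)] [∀ i, Module k (N i)] {η : ι → Type*}
    (b : ∀ i, Module.Basis (η i) k (N i)) (i : ι) (x : η i) :
    DFinsupp.basis b ⟨i, x⟩ = DFinsupp.single i (b i x) := by
  refine Module.Basis.apply_eq_iff.mpr ?_
  ext ⟨j, y⟩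
  change (b j).repr ((DFinsupp.single i (b i x)) j) y = _
  by_cases h : i = j
  · cases h
    simp [Finsupp.single_apply_left sigma_mk_injective]
  · have h' : (⟨i, x⟩ : Σ i, η i) ≠ ⟨j, y⟩ := fun hh => h (congrArg Sigma.fst hh)
    rw [DFinsupp.single_eq_of_ne (Ne.symm h), Finsupp.single_eq_of_ne (Ne.symm h')]
    simp

theorem exists_hasJordanType [FiniteDimensional k V] (φ : Module.End k V) (hφ : IsNilpotent φ) :
    ∃ c, HasJordanType φ c := by
  classical
  obtain ⟨n, hn⟩ := hφ
  have htors : Module.IsTorsion' (Module.AEval' φ) (Submonoid.powers (X : k[X])) := by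
    intro x
    refine ⟨⟨X ^ n, n, rfl⟩, ?_⟩
    obtain ⟨y, rfl⟩ := (Module.AEval'.of φ).surjective x
    change (X ^ n : k[X]) • (Module.AEval.of k V φ y) = 0
    rw [← Module.AEval.of_aeval_smul]
    simp [hn]
  obtain ⟨d, κ, ⟨e⟩⟩ := Module.torsion_by_prime_power_decomposition (p := (X : k[X]))
    irreducible_X htors
  choose B hB using fun i : Fin d => exists_basis_quotient_X_pow (k := k) (κ i)
  let c : ℕ → ℕ := fun i => Fintype.card {a : Fin d // κ a = i ∧ i ≠ 0}
  let E : (Σ a : Fin d, Fin (κ a)) ≃ (Σ i : ℕ, Fin (c i) × Fin i) :=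
    { toFun := fun x => ⟨κ x.1, Fintype.equivFin _ ⟨x.1, rfl, by have := x.2.2; omega⟩, x.2⟩
      invFun := fun y => ⟨((Fintype.equivFin _).symm y.2.1).1,
        y.2.2.cast ((Fintype.equivFin {a : Fin d // κ a = y.1 ∧ y.1 ≠ 0}).symm y.2.1).2.1.symm⟩
      left_inv := by
        rintro ⟨a, j⟩
        have : ∀ (z : {b : Fin d // κ b = κ a ∧ κ a ≠ 0}) (hz : z = ⟨a, rfl, by omega⟩),
            (⟨z.1, j.cast z.2.1.symm⟩ : Σ a : Fin d, Fin (κ a)) = ⟨a, j⟩ := by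
          intro z hz; rw [hz]; rfl
        exact this _ (Equiv.symm_apply_apply _ _)
      right_inv := by
        rintro ⟨i, l, j⟩
        obtain ⟨⟨a, h, h'⟩, rfl⟩ := (Fintype.equivFin {a : Fin d // κ a = i ∧ i ≠ 0}).surjective l
        subst h
        have : ∀ (z : {b : Fin d // κ b = κ a ∧ κ a ≠ 0}) (hz : z = ⟨a, rfl, h'⟩),
            (⟨κ z.1, Fintype.equivFin _ ⟨z.1, rfl, by rw [z.2.1]; exact h'⟩,
              j.cast z.2.1.symm⟩ : Σ i : ℕ, Fin (c i) × Fin i) =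
            ⟨κ a, Fintype.equivFin _ ⟨a, rfl, h'⟩, j⟩ := by
          intro z hz; rw [hz]; rfl
        exact this _ (Equiv.symm_apply_apply _ _) }
  refine ⟨c, ?_, ?_⟩
  · simp [c]
  let b1 : Module.Basis (Σ a : Fin d, Fin (κ a)) k
    (DirectSum (Fin d) fun i => k[X] ⧸ (Submodule.span k[X] {(X : k[X]) ^ κ i})) := DFinsupp.basis B
  let b := ((b1.map (e.restrictScalars k).symm).map (Module.AEval'.of φ).symm)
  have hb : ∀ x, b x = (Module.AEval'.of φ).symm (e.symm (DirectSum.of _ x.1 (B x.1 x.2))) := by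
    intro x
    have h1 : b1 x = DirectSum.of (fun i => k[X] ⧸ (Submodule.span k[X] {(X : k[X]) ^ κ i}))
        x.1 (B x.1 x.2) := by
      exact dfinsupp_basis_apply B x.1 x.2
    change (Module.AEval'.of φ).symm (e.symm (b1 x)) = _
    rw [h1]
  have hbφ : ∀ (a : Fin d) (j : Fin (κ a)), φ (b ⟨a, j⟩) =
      if h : (j : ℕ) + 1 < κ a then b ⟨a, ⟨(j : ℕ) + 1, h⟩⟩ else 0 := by
    intro a j
    have h1 : ∀ y : Module.AEval' φ,
        φ ((Module.AEval'.of φ).symm y) = (Module.AEval'.of φ).symm ((X : k[X]) • y) := by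
      intro y
      obtain ⟨v, rfl⟩ := (Module.AEval'.of φ).surjective y
      rw [Module.AEval'.X_smul_of]
      simp
    rw [hb, h1, ← map_smul, ← DirectSum.of_smul, hB]
    split_ifs with h
    · rw [hb]
    · simp
  refine ⟨b.reindex E, fun i l j => ?_⟩
  obtain ⟨⟨a, h, h'⟩, rfl⟩ := (Fintype.equivFin {a : Fin d // κ a = i ∧ i ≠ 0}).surjective l
  subst h
  have hE : ∀ j : Fin (κ a), E.symm ⟨κ a, Fintype.equivFin _ ⟨a, rfl, h'⟩, j⟩ = ⟨a, j⟩ :=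
    fun j => (Equiv.symm_apply_eq _).2 rfl
  simp only [Module.Basis.reindex_apply]
  rw [hE, hbφ]
  split_ifs with h
  · rw [hE]
  · rfl

/-- The rank of the powers of an endomorphism with a given Jordan type. -/
theorem HasJordanType.finrank_range_pow [FiniteDimensional k V] {φ : Module.End k V} {c : ℕ → ℕ}
    (h : HasJordanType φ c) (m N : ℕ) (hN : Module.finrank k V ≤ N) :
    Module.finrank k (LinearMap.range (φ ^ m)) = ∑ i ∈ Finset.Icc m N, (i - m) * c i := by
  obtain ⟨-, b, hb⟩ := h
  have : Finite (Σ i : ℕ, Fin (c i) × Fin i) := Module.Finite.finite_basis b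
  have hci : ∀ i, c i ≠ 0 → i ≤ N := by
    intro i hi
    have h1 : Nat.card (Fin i) ≤ Nat.card (Σ i : ℕ, Fin (c i) × Fin i) :=
      Nat.card_le_card_of_injective
        (fun j : Fin i => (⟨i, ⟨0, Nat.pos_of_ne_zero hi⟩, j⟩ : Σ i : ℕ, Fin (c i) × Fin i))
        (fun j j' hj => by simpa using hj)
    rw [Nat.card_fin, ← Module.finrank_eq_nat_card_basis b] at h1
    exact h1.trans hN
  have hpow : ∀ (m i : ℕ) (l : Fin (c i)) (j : Fin i), (φ ^ m) (b ⟨i, l, j⟩) =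
      if h : (j : ℕ) + m < i then b ⟨i, l, ⟨(j : ℕ) + m, h⟩⟩ else 0 := by
    intro m
    induction m with
    | zero => intro i l j; simp
    | succ m ih =>
      intro i l j
      rw [pow_succ', Module.End.mul_apply, ih]
      by_cases h1 : (j : ℕ) + m < i
      · rw [dif_pos h1, hb]
        simp only [add_assoc]
      · rw [dif_neg h1, dif_neg (by omega), map_zero]
  let f : (Σ i : ℕ, Fin (c i) × Fin (i - m)) → (Σ i : ℕ, Fin (c i) × Fin i) :=
    fun y => ⟨y.1, y.2.1, ⟨(y.2.2 : ℕ) + m, by have := y.2.2.2; omega⟩⟩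
  have hf : Function.Injective f := by
    rintro ⟨i, l, j⟩ ⟨i', l', j'⟩ h
    simp only [f, Sigma.mk.injEq] at h
    obtain ⟨rfl, h⟩ := h
    simp only [heq_eq_eq, Prod.mk.injEq, Fin.mk.injEq, add_left_inj] at h
    obtain ⟨rfl, h⟩ := h
    rw [Fin.ext h]
  have : Finite (Σ i : ℕ, Fin (c i) × Fin (i - m)) := Finite.of_injective f hf
  have := Fintype.ofFinite (Σ i : ℕ, Fin (c i) × Fin (i - m))
  have hrange : LinearMap.range (φ ^ m) = Submodule.span k (Set.range (b ∘ f)) := by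
    apply le_antisymm
    · rw [LinearMap.range_eq_map, ← b.span_eq, Submodule.map_span, Submodule.span_le]
      rintro _ ⟨_, ⟨⟨i, l, j⟩, rfl⟩, rfl⟩
      rw [hpow]
      split_ifs with h
      · exact Submodule.subset_span ⟨⟨i, l, ⟨j, by omega⟩⟩, rfl⟩
      · exact Submodule.zero_mem _
    · rw [Submodule.span_le]
      rintro _ ⟨⟨i, l, j⟩, rfl⟩
      refine ⟨b ⟨i, l, ⟨j, by omega⟩⟩, ?_⟩
      rw [hpow, dif_pos (by have := j.2; simp only; omega)]
      rfl
  rw [hrange, finrank_span_eq_card (b.linearIndependent.comp f hf), ← Nat.card_eq_fintype_card]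
  let g : (Σ i : ℕ, Fin (c i) × Fin (i - m)) ≃
      (Σ i : {i // i ∈ Finset.Icc m N}, Fin (c i) × Fin (i - m)) :=
    { toFun := fun y => ⟨⟨y.1, Finset.mem_Icc.2 ⟨by have := y.2.2.2; omega,
        hci _ (by have := y.2.1.2; omega)⟩⟩, y.2⟩
      invFun := fun y => ⟨y.1, y.2⟩
      left_inv := fun _ => rfl
      right_inv := fun _ => rfl }
  rw [Nat.card_congr g, Nat.card_sigma, ← Finset.sum_coe_sort (Finset.Icc m N)]
  refine Finset.sum_congr rfl fun i _ => ?_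
  rw [Nat.card_prod, Nat.card_fin, Nat.card_fin, mul_comm]

theorem HasJordanType.eq [FiniteDimensional k V] {φ : Module.End k V} {c c' : ℕ → ℕ}
    (h : HasJordanType φ c) (h' : HasJordanType φ c') : c = c' := by
  -- second differences of the ranks recover the multiplicities
  have key : ∀ c : ℕ → ℕ, HasJordanType φ c → ∀ i : ℕ,
      c (i + 1) + 2 * Module.finrank k (LinearMap.range (φ ^ (i + 1))) =
        Module.finrank k (LinearMap.range (φ ^ i)) +
          Module.finrank k (LinearMap.range (φ ^ (i + 2))) := by
    intro c hc i
    set N := Module.finrank k V + i + 2 with hN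
    have hNV : Module.finrank k V ≤ N := by omega
    rw [hc.finrank_range_pow _ N hNV, hc.finrank_range_pow _ N hNV,
      hc.finrank_range_pow _ N hNV]
    have split : ∀ (a : ℕ) (_ : a ≤ N) (g : ℕ → ℕ),
        ∑ x ∈ Finset.Icc a N, g x = g a + ∑ x ∈ Finset.Icc (a + 1) N, g x := by
      intro a ha g
      rw [← Finset.add_sum_Ioc_eq_sum_Icc ha, Finset.Icc_add_one_left_eq_Ioc]
    rw [split i (by omega) (fun x => (x - i) * c x),
      split (i + 1) (by omega) (fun x => (x - i) * c x),
      split (i + 1) (by omega) (fun x => (x - (i + 1)) * c x)]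
    have : ∑ x ∈ Finset.Icc (i + 1 + 1) N, (x - i) * c x +
        ∑ x ∈ Finset.Icc (i + 2) N, (x - (i + 2)) * c x =
        2 * ∑ x ∈ Finset.Icc (i + 1 + 1) N, (x - (i + 1)) * c x := by
      rw [← Finset.sum_add_distrib, Finset.mul_sum]
      refine Finset.sum_congr rfl fun x hx => ?_
      obtain ⟨y, rfl⟩ := Nat.exists_eq_add_of_le (Finset.mem_Icc.1 hx).1
      rw [show i + 1 + 1 + y - i = y + 2 by omega, show i + 1 + 1 + y - (i + 2) = y by omega,
        show i + 1 + 1 + y - (i + 1) = y + 1 by omega]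
      ring
    simp only [Nat.sub_self, zero_mul, zero_add, Nat.add_sub_cancel_left, one_mul]
    linarith
  funext i
  rcases i with _ | i
  · rw [h.1, h'.1]
  · have h1 := key c h i
    have h2 := key c' h' i
    omega

/-- The Jordan type of a nilpotent endomorphism exists and is unique. -/
theorem hasJordanType_iff [FiniteDimensional k V] {φ : Module.End k V} (hφ : IsNilpotent φ)
    (c : ℕ → ℕ) : HasJordanType φ c ↔ c = jordanType φ := by
  have hex := exists_hasJordanType φ hφ
  have h : HasJordanType φ (jordanType φ) := by
    rw [jordanType, dif_pos hex]
    exact hex.choose_spec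
  exact ⟨fun hc => hc.eq h, fun hc => hc ▸ h⟩

end JordanType

/-! ## Rational `𝔾ₐ`-modules -/

/-- A (right) comodule structure on `M` for the `k`-coalgebra `C`. -/
structure RightComodule (k : Type u) (C : Type u) (M : Type v) [Field k] [AddCommGroup C]
    [Module k C] [Coalgebra k C] [AddCommGroup M] [Module k M] where
  /-- the coaction `Δ_M : M → M ⊗ C` -/
  coact : M →ₗ[k] M ⊗[k] C
  coassoc : (TensorProduct.assoc k M C C).toLinearMap ∘ₗ coact.rTensor C ∘ₗ coact =
    (Coalgebra.comul (R := k) (A := C)).lTensor M ∘ₗ coact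
  counit_coact : (TensorProduct.rid k M).toLinearMap ∘ₗ
    (Coalgebra.counit (R := k) (A := C)).lTensor M ∘ₗ coact = LinearMap.id

/-- A rational `𝔾ₐ`-module structure on `M`. -/
abbrev RationalGaModule (k : Type u) (M : Type v) [Field k] [AddCommGroup M] [Module k M] :
    Type (max u v) :=
  RightComodule k k[X] M

section Action

variable {k : Type u} [Field k] {M : Type v} [AddCommGroup M] [Module k M]

namespace RightComodule

/-- A functional `φ` on the coalgebra acts by `m ↦ ∑ φ(f_i) m_i` where `Δ_M(m) = ∑ m_i ⊗ f_i`. -/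
noncomputable def act {C : Type u} [AddCommGroup C] [Module k C] [Coalgebra k C]
    (ρ : RightComodule k C M) (φ : C →ₗ[k] k) : Module.End k M :=
  (TensorProduct.rid k M).toLinearMap ∘ₗ φ.lTensor M ∘ₗ ρ.coact

end RightComodule

namespace RationalGaModule

/-- `M` has degree `< n`: the coaction satisfies `Δ_M(M) ⊆ M ⊗ k[T]_{<n}`. -/
def HasDegreeLT (ρ : RationalGaModule k M) (n : ℕ) : Prop :=
  LinearMap.range ρ.coact ≤ LinearMap.range ((degreeLT k n).subtype.lTensor M)

/-- The action of `𝔾ₐ` on `M` at the 1-parameter subgroup `ψ = σ_a`, namely that of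
`∑_s (σ_{a_s})_*(u_s)`, where `u_s` reads off the coefficient of `T^(p^s)` and `σ_x` is
multiplication by the scalar `x`. -/
noncomputable def action (p : ℕ) [Fact p.Prime] [CharP k p] (ρ : RationalGaModule k M)
    (ψ : OneParam k) : Module.End k M :=
  (oneParamCoord p ψ).sum fun s x =>
    ρ.act (lcoeff k (p ^ s) ∘ₗ (sigma p (Finsupp.single 0 x)).toCoalgHom.toLinearMap)

/-- The action of `𝔾ₐ₍ᵣ₎` on `M` at the infinitesimal 1-parameter subgroup `μ`, namely that of
`μ_*(u_{r-1})`, where `u_{r-1}` reads off the coefficient of `T^(p^(r-1))`. -/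
noncomputable def infAction {p r : ℕ} [Fact p.Prime] [CharP k p] (ρ : RationalGaModule k M)
    (μ : InfOneParam k p r) : Module.End k M :=
  ρ.act (frobCoeff p r (p ^ (r - 1)) ∘ₗ μ.toCoalgHom.toLinearMap)

/-- The action at `σ_a` is that of `∑_s a_s^(p^s) u_s`. -/
theorem action_sigma (p : ℕ) [hp : Fact p.Prime] [CharP k p] (ρ : RationalGaModule k M)
    (a : ℕ →₀ k) :
    ρ.action p (sigma p a) = a.sum fun s x => x ^ p ^ s • ρ.act (lcoeff k (p ^ s)) := by
  have h : oneParamCoord p (sigma p a) = a := (oneParamEquiv k p).left_inv a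
  rw [action, h]
  refine Finsupp.sum_congr fun s _ => ?_
  have h1 : lcoeff k (p ^ s) ∘ₗ (sigma p (Finsupp.single 0 (a s))).toCoalgHom.toLinearMap =
      (a s) ^ p ^ s • lcoeff k (p ^ s) := by
    have hX : sigma p (Finsupp.single 0 (a s)) X = C (a s) * X := by
      rw [sigma, primitiveHom_X]
      by_cases h0 : a s = 0
      · simp [h0]
      · rw [Finsupp.support_single _ h0]
        simp [smul_eq_C_mul]
    ext n
    change (sigma p (Finsupp.single 0 (a s)) (monomial n 1)).coeff (p ^ s) =
      (a s) ^ p ^ s • (monomial n (1 : k)).coeff (p ^ s)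
    rw [monomial_one_right_eq_X_pow, map_pow, hX, mul_pow, ← C_pow, coeff_C_mul, coeff_X_pow]
    split_ifs with h2
    · rw [h2]; simp
    · simp
  rw [h1, RightComodule.act, RightComodule.act, LinearMap.lTensor_smul, LinearMap.smul_comp,
    LinearMap.comp_smul]

/-- The Jordan type `JT_{𝔾ₐ,M}(ψ)`. -/
noncomputable def JT (p : ℕ) [Fact p.Prime] [CharP k p] (ρ : RationalGaModule k M)
    (ψ : OneParam k) : ℕ → ℕ :=
  jordanType (ρ.action p ψ)

/-- The Jordan type `JT_{𝔾ₐ₍ᵣ₎,M}(μ)`. -/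
noncomputable def infJT {p r : ℕ} [Fact p.Prime] [CharP k p] (ρ : RationalGaModule k M)
    (μ : InfOneParam k p r) : ℕ → ℕ :=
  jordanType (ρ.infAction μ)

end RationalGaModule

/-- `M` is free as a module over `k[u]/(u^p)`, with `u` acting as `φ`: as a `k[u]`-module, it is
isomorphic to a direct sum of copies of `k[u]/(u^p)`. -/
def IsFreeTruncated (p : ℕ) (φ : Module.End k M) : Prop :=
  ∃ ι : Type v, Nonempty (Module.AEval' φ ≃ₗ[k[X]] (ι →₀ (k[X] ⧸ Ideal.span {(X : k[X]) ^ p})))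

/-- The support variety `V_r(𝔾ₐ)_M`, as the set of its `k`-points. -/
def RationalGaModule.infSupport (p r : ℕ) [Fact p.Prime] [CharP k p] (ρ : RationalGaModule k M) :
    Set (InfOneParam k p r) :=
  {μ | ¬ IsFreeTruncated p (ρ.infAction μ)}

end Action

/-! ## The order on Jordan types, and the maps `λ_r` and `q_{r+c,r}` -/

/-- The dominance order on Jordan types `∑ c_i [i]` with blocks of size at most `p` (for
endomorphisms of spaces of the same dimension): for every `j`, the Young diagram of the smaller type
has at most as many boxes outside the first `j` columns. -/
def JordanLE (p : ℕ) (c d : ℕ → ℕ) : Prop :=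
  ∀ j, ∑ i ∈ Finset.Icc j p, (i - j) * c i ≤ ∑ i ∈ Finset.Icc j p, (i - j) * d i

/-- `λ_r(a_0, a_1, …) = (a_{r-1}, …, a_0)`. -/
def lambdaSeq {k : Type u} [Field k] (r : ℕ) (a : ℕ →₀ k) : Fin r → k :=
  fun i => a (r - 1 - i)

/-- `q_{r+c,r} : V_{r+c}(𝔾ₐ) → V_r(𝔾ₐ)`, sending `σ_(a_0, …, a_{r+c-1})` to
`σ_(a_c, …, a_{r+c-1})`. -/
noncomputable def qMap {k : Type u} [Field k] (p : ℕ) [Fact p.Prime] [CharP k p] (r c : ℕ)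
    (μ : InfOneParam k p (r + c)) : InfOneParam k p r :=
  infSigma p fun i : Fin r => (infOneParamEquiv k p (r + c)).symm μ ⟨c + i, by omega⟩

/-! ## Ranks of powers and cokernels -/

section RankPow

variable {k : Type*} [Field k] {V : Type*} [AddCommGroup V] [Module k V]

/-! Let `v n` be the action on `M` of the functional reading off the coefficient of `T^n`. Since `T`
is primitive, `v i * v j` is `(i+j choose i)` times `v (i+j)`. So the `v n` lie in a commutative
algebra, `v n` is `p`-nilpotent for `n > 0`, and, if `n > 0` is not a power of `p`, it is a scalar
multiple of a product of two `v`'s of smaller positive index. As `v n = 0` for `n ≥ p^r`, the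
operator of `σ_b`, with `b` of length `R ≥ r`, is a linear part `∑ c_s v (p^s)`, where `c_s =
b_{R-1-s}^(p^s)` and `s < r`, plus an error `∑ γ_s v (p^s)` with nilpotent `γ_s` (`exists_model`).
For `R = r` and `λ_r(a) = b`, the linear part is the operator of `𝔾ₐ` at `σ_a`. The theorem thus
says that the error is harmless at a maximal point.

For `p`-nilpotent operators dominance is the comparison of the ranks of all powers
(`jordanLE_jordanType_iff`), so each power `j` can be treated alone. The key is
`Matrix.exists_generic_rank_pencil`: if `R` is the generic rank of `(α + Xβ)^j` over `k[X]`, then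
replacing `X` by a nilpotent `γ` commuting with `α` and `β` gives rank at most `R`, with equality if
`α^j` already has rank `R`. To see this, choose a power `q` of `p` with `γ^q = 0`, and let `C` be
the cokernel of `(α + Xβ)^j` on `(k[X]/(X^(2q)))^n`. Then `(α + γβ)^j` has cokernel `C/(X - γ)C`,
and `dim C ≥ 2q(n - R)` forces the first claim. If `α^j` has rank `R`, then `C` is free over
`k[X]/(X^(2q))`. Freeness depends only on the action of `X^q = (X - γ)^q`, so `C/(X - γ)C` has the
same dimension as `C/XC`.

Treating the summands of the error one at a time (`powRank_add_sum_eq`), an error does not change a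
rank that is maximal among linear combinations, nor can it exceed that maximum. All ranks are
maximized simultaneously by one linear combination, whose coefficients come from some `b` because
`k` is perfect; hence every maximal `b` attains all maximal ranks. For supports, freeness means that
the rank of the operator is as large as `p`-nilpotency allows, so it depends only on the linear
part, and `q_{r+c,r}` preserves the linear part. -/

theorem finrank_range_pow_eq [FiniteDimensional k V] (f : Module.End k V) (j : ℕ) :
    Module.finrank k (LinearMap.range (f ^ j)) = Module.finrank k (LinearMap.range (f ^ (j + 1))) +
      Module.finrank k ↥(LinearMap.ker f ⊓ LinearMap.range (f ^ j)) := by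
  have h := LinearMap.finrank_range_add_finrank_ker (f.domRestrict (LinearMap.range (f ^ j)))
  have h1 : LinearMap.range (f.domRestrict (LinearMap.range (f ^ j))) =
      LinearMap.range (f ^ (j + 1)) := by
    rw [LinearMap.range_domRestrict, pow_succ', ← LinearMap.range_comp]
    rfl
  have h2 : Module.finrank k (LinearMap.ker (f.domRestrict (LinearMap.range (f ^ j)))) =
      Module.finrank k ↥(LinearMap.ker f ⊓ LinearMap.range (f ^ j)) := by
    rw [LinearMap.ker_domRestrict, inf_comm, ← Submodule.map_comap_subtype]
    exact (LinearEquiv.finrank_eq (Submodule.equivMapOfInjective _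
      (Submodule.injective_subtype _) _))
  rw [← h, h1, h2]

theorem range_pow_antitone (f : Module.End k V) :
    Antitone fun j => LinearMap.range (f ^ j) := by
  refine antitone_nat_of_succ_le fun j => ?_
  rw [pow_succ]
  exact LinearMap.range_comp_le_range _ _

theorem finrank_ker_inf_range_antitone [FiniteDimensional k V] (f : Module.End k V) :
    Antitone fun j => Module.finrank k ↥(LinearMap.ker f ⊓ LinearMap.range (f ^ j)) :=
  fun _ _ h => Submodule.finrank_mono (inf_le_inf_left _ (range_pow_antitone f h))

/-- The drop in rank from `f^i` to `f^(i+1)` is the dimension of `ker f ⊓ range (f^i)`, which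
decreases with `i`. So none of the `m` drops exceeds the first. -/
theorem finrank_range_pow_le_add [FiniteDimensional k V] (f : Module.End k V) (i m : ℕ) :
    Module.finrank k (LinearMap.range (f ^ i)) ≤ Module.finrank k (LinearMap.range (f ^ (i + m))) +
      m * Module.finrank k ↥(LinearMap.ker f ⊓ LinearMap.range (f ^ i)) := by
  induction m with
  | zero => simp
  | succ m ih =>
    have h1 := finrank_range_pow_eq f (i + m)
    have h2 := finrank_ker_inf_range_antitone f (Nat.le_add_right i m)
    dsimp only at h2
    rw [← add_assoc, add_one_mul]
    omega

/-- Each of the `m` drops in rank is at least the value of `ker f ⊓ range (f^·)` at the last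
exponent. -/
theorem add_le_finrank_range_pow [FiniteDimensional k V] (f : Module.End k V) (i m : ℕ) :
    Module.finrank k (LinearMap.range (f ^ (i + m))) +
      m * Module.finrank k ↥(LinearMap.ker f ⊓ LinearMap.range (f ^ (i + m))) ≤
        Module.finrank k (LinearMap.range (f ^ i)) := by
  induction m with
  | zero => simp
  | succ m ih =>
    have h1 := finrank_range_pow_eq f (i + m)
    have h2 := finrank_ker_inf_range_antitone f (Nat.le_succ (i + m))
    dsimp only at h2
    have h3 := Nat.mul_le_mul_left m h2
    rw [← add_assoc, add_one_mul]
    simp only [Nat.succ_eq_add_one] at *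
    omega

theorem finrank_ker_inf_range_zero (f : Module.End k V) :
    Module.finrank k ↥(LinearMap.ker f ⊓ LinearMap.range (f ^ 0)) =
      Module.finrank k (LinearMap.ker f) := by
  rw [pow_zero, Module.End.one_eq_id, LinearMap.range_id, inf_top_eq]

theorem finrank_range_pow_zero (f : Module.End k V) :
    Module.finrank k (LinearMap.range (f ^ 0)) = Module.finrank k V := by
  rw [pow_zero, Module.End.one_eq_id, LinearMap.range_id, finrank_top]

theorem finrank_range_eq_zero {f : Module.End k V} (hf : f = 0) :
    Module.finrank k (LinearMap.range f) = 0 := by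
  rw [hf, LinearMap.range_zero, finrank_bot]

/-- There are `dim ker f` Jordan blocks, each of size at most `N`. Equality characterizes freeness
over `k[f]/(f^N)`, and is used in this role below. -/
theorem finrank_le_mul_finrank_ker [FiniteDimensional k V] {f : Module.End k V} {N : ℕ}
    (hf : f ^ N = 0) :
    Module.finrank k V ≤ N * Module.finrank k (LinearMap.ker f) := by
  have h := finrank_range_pow_le_add f 0 N
  rwa [finrank_range_pow_zero, finrank_ker_inf_range_zero, zero_add, finrank_range_eq_zero hf,
    zero_add] at h

/-- Over `k[s]/(s^(2q))`, freeness of a module only depends on the action of `s^q`. -/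
theorem finrank_ker_eq_of_pow_eq [FiniteDimensional k V] {f s : Module.End k V} {q : ℕ} (hq : 0 < q)
    (hfs : f ^ q = s ^ q) (hs : s ^ (2 * q) = 0)
    (hV : Module.finrank k V = 2 * q * Module.finrank k (LinearMap.ker s)) :
    Module.finrank k (LinearMap.ker f) = Module.finrank k (LinearMap.ker s) := by
  obtain ⟨d, hd⟩ : ∃ d, Module.finrank k (LinearMap.ker s) = d := ⟨_, rfl⟩
  rw [hd] at hV ⊢
  have hf : f ^ (q + q) = 0 := by rw [pow_add, hfs, ← pow_add, ← two_mul, hs]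
  have s1 := finrank_range_pow_le_add s 0 q
  have s2 := finrank_range_pow_le_add s q q
  have s3 := finrank_ker_inf_range_antitone s (Nat.zero_le q)
  dsimp only at s3
  rw [finrank_range_pow_zero, finrank_ker_inf_range_zero, zero_add, hd] at s1
  rw [finrank_ker_inf_range_zero, hd] at s3
  rw [← two_mul, finrank_range_eq_zero hs] at s2
  have s4 := Nat.mul_le_mul_left q s3
  -- Freeness forces the rank of `s^q` to be exactly half of `2qd`, and `f^q = s^q` has the same
  -- rank.
  have hsq : Module.finrank k (LinearMap.range (f ^ q)) = q * d := by
    rw [hfs]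
    rw [hV, mul_assoc, two_mul] at s1
    omega
  have f1 := finrank_range_pow_le_add f q q
  rw [finrank_range_eq_zero hf, hsq, zero_add] at f1
  have f1' := Nat.le_of_mul_le_mul_left f1 hq
  -- By `f1'`, `ker f ⊓ range (f^q)` has dimension at least `d`. Hence `f` has rank at least `qd +
  -- (q-1)d = (2q-1)d`, so its kernel has dimension at most `d`; the reverse inequality is `f1'`
  -- with `f4`.
  have f2 := add_le_finrank_range_pow f 1 (q - 1)
  rw [Nat.add_sub_cancel' hq, hsq] at f2
  have f3 := finrank_range_pow_eq f 0
  rw [finrank_range_pow_zero, finrank_ker_inf_range_zero, zero_add, hV] at f3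
  have f4 := finrank_ker_inf_range_antitone f (Nat.zero_le q)
  dsimp only at f4
  rw [finrank_ker_inf_range_zero] at f4
  have f5 := Nat.mul_le_mul_left (q - 1) f1'
  obtain ⟨m, rfl⟩ : ∃ m, q = m + 1 := ⟨q - 1, by omega⟩
  simp only [Nat.add_sub_cancel] at *
  rw [mul_assoc, two_mul, add_one_mul] at f3
  rw [add_one_mul] at f2
  omega

/-! ### Commuting endomorphisms on a cokernel. -/

theorem range_le_comap_range_of_commute {T f : Module.End k V} (h : Commute T f) :
    LinearMap.range T ≤ (LinearMap.range T).comap f := by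
  rintro _ ⟨v, rfl⟩
  exact ⟨f v, DFunLike.congr_fun h.eq v⟩

/-- The endomorphism induced on the cokernel of `T` by an endomorphism `f` commuting with `T`. -/
def cokerMap {T f : Module.End k V} (h : Commute T f) : Module.End k (V ⧸ LinearMap.range T) :=
  Submodule.mapQ _ _ f (range_le_comap_range_of_commute h)

theorem cokerMap_pow {T f : Module.End k V} (h : Commute T f) (j : ℕ) :
    cokerMap h ^ j = cokerMap (h.pow_right j) := by
  induction j with
  | zero => ext v; rfl
  | succ j ih =>
    rw [pow_succ, ih]
    apply Submodule.linearMap_qext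
    ext v
    change Submodule.Quotient.mk ((f ^ j) (f v)) = Submodule.Quotient.mk ((f ^ (j + 1)) v)
    rw [pow_succ]
    rfl

theorem cokerMap_pow_eq_zero {T f : Module.End k V} (h : Commute T f) {j : ℕ} (hj : f ^ j = 0) :
    cokerMap h ^ j = 0 := by
  rw [cokerMap_pow]
  ext v
  simp [cokerMap, hj]

theorem cokerMap_pow_eq_pow {T f s : Module.End k V} (h : Commute T f) (h' : Commute T s) {j : ℕ}
    (hj : f ^ j = s ^ j) : cokerMap h ^ j = cokerMap h' ^ j := by
  rw [cokerMap_pow, cokerMap_pow]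
  ext v
  simp [cokerMap, hj]

variable {M : Type*} [AddCommGroup M] [Module k M] [FiniteDimensional k M]

/-- `E` identifies `V/fV` with `M` and `T` with `P`, so `coker P` is `V/(TV + fV)`, which is also
the cokernel of `f` on `V/TV`. For an endomorphism of a finite dimensional space, kernel and
cokernel have equal dimension. -/
theorem finrank_ker_cokerMap [FiniteDimensional k V] {T f : Module.End k V} (h : Commute T f)
    {E : V →ₗ[k] M}
    (hE : Function.Surjective E) (hker : LinearMap.ker E = LinearMap.range f) {P : Module.End k M}
    (hP : E ∘ₗ T = P ∘ₗ E) :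
    Module.finrank k (LinearMap.ker (cokerMap h)) + Module.finrank k (LinearMap.range P) =
      Module.finrank k M := by
  have hP' : ∀ v, E (T v) = P (E v) := fun v => DFunLike.congr_fun hP v
  have hle : LinearMap.range T ≤ (LinearMap.range P).comap E := by
    rintro _ ⟨v, rfl⟩
    exact ⟨E v, (hP' v).symm⟩
  set Ē := Submodule.mapQ (LinearMap.range T) (LinearMap.range P) E hle with hĒ
  have hsurj : Function.Surjective Ē := by
    intro y
    obtain ⟨m, rfl⟩ := Submodule.mkQ_surjective _ y
    obtain ⟨v, rfl⟩ := hE m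
    exact ⟨Submodule.Quotient.mk v, rfl⟩
  have hkerĒ : LinearMap.ker Ē = LinearMap.range (cokerMap h) := by
    ext y
    obtain ⟨v, rfl⟩ := Submodule.mkQ_surjective _ y
    constructor
    · intro hv
      have hv' : E v ∈ LinearMap.range P := (Submodule.Quotient.mk_eq_zero _).1 hv
      obtain ⟨m, hm⟩ := hv'
      obtain ⟨w, rfl⟩ := hE m
      have : v - T w ∈ LinearMap.ker E := by
        rw [LinearMap.mem_ker, map_sub, hP', hm, sub_self]
      rw [hker] at this
      obtain ⟨z, hz⟩ := this
      refine ⟨Submodule.Quotient.mk z, ?_⟩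
      change Submodule.Quotient.mk (f z) = Submodule.Quotient.mk v
      rw [Submodule.Quotient.eq]
      exact ⟨-w, by rw [hz, map_neg]; abel⟩
    · rintro ⟨z, hz⟩
      obtain ⟨w, rfl⟩ := Submodule.mkQ_surjective _ z
      rw [← hz]
      have : E (f w) = 0 := LinearMap.mem_ker.1 (hker ▸ ⟨w, rfl⟩)
      change Submodule.Quotient.mk (E (f w)) = 0
      rw [this, Submodule.Quotient.mk_zero]
  have h1 := LinearMap.finrank_range_add_finrank_ker Ē
  have h2 := LinearMap.finrank_range_add_finrank_ker (cokerMap h)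
  have h3 := Submodule.finrank_quotient_add_finrank (LinearMap.range P)
  rw [LinearMap.range_eq_top.2 hsurj, finrank_top, hkerĒ] at h1
  omega

end RankPow

/-! ## Matrices of polynomials -/

section PolynomialMatrix

/-- Over a principal ideal domain, a matrix factors through a free module whose rank is that of a
nonsingular diagonal matrix obtained from it. -/
theorem Matrix.exists_rank_factorization {A : Type*} [CommRing A] [IsDomain A]
    [IsPrincipalIdealRing A] {n : Type*} [Fintype n] [DecidableEq n] (X : Matrix n n A) :
    ∃ (R : ℕ) (B : Matrix n (Fin R) A) (C P : Matrix (Fin R) n A) (Q : Matrix n (Fin R) A)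
      (a : Fin R → A), X = B * C ∧ P * X * Q = Matrix.diagonal a ∧ ∀ i, a i ≠ 0 := by
  -- Smith normal form of the image of `X`. The factorization goes through a basis of the image; `Q`
  -- picks preimages of that basis, and `P` reads the coordinates in the adapted basis of the
  -- ambient module.
  obtain ⟨R, s⟩ := Submodule.smithNormalForm (Pi.basisFun A n) (LinearMap.range X.mulVecLin)
  choose q hq using fun i => (s.bN i).2
  let c : (n → A) →ₗ[A] (Fin R → A) := s.bN.equivFun.toLinearMap ∘ₗ X.mulVecLin.rangeRestrict
  let b : (Fin R → A) →ₗ[A] (n → A) :=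
    (LinearMap.range X.mulVecLin).subtype ∘ₗ s.bN.equivFun.symm.toLinearMap
  let P : (n → A) →ₗ[A] (Fin R → A) := LinearMap.pi fun i => s.bM.coord (s.f i)
  let Q : (Fin R → A) →ₗ[A] (n → A) := Fintype.linearCombination A q
  refine ⟨R, LinearMap.toMatrix' b, LinearMap.toMatrix' c, LinearMap.toMatrix' P,
    LinearMap.toMatrix' Q, s.a, ?_, ?_, ?_⟩
  · rw [← LinearMap.toMatrix'_comp]
    apply Matrix.toLin'.injective
    rw [Matrix.toLin'_toMatrix']
    refine LinearMap.ext fun w => ?_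
    simp [b, c]
  · have : X = LinearMap.toMatrix' X.mulVecLin := (LinearMap.toMatrix'_toLin' X).symm
    have h2 : LinearMap.toMatrix' P * X * LinearMap.toMatrix' Q =
        LinearMap.toMatrix' (P ∘ₗ X.mulVecLin ∘ₗ Q) := by
      rw [LinearMap.toMatrix'_comp, LinearMap.toMatrix'_comp, ← this, Matrix.mul_assoc]
    rw [h2]
    ext i j
    have h1 : Q (Pi.single j 1) = q j := by simp [Q]
    rw [LinearMap.toMatrix'_apply, LinearMap.comp_apply, LinearMap.comp_apply, h1, hq, s.snf]
    simp only [map_smul, LinearMap.pi_apply, Module.Basis.coord_apply, Module.Basis.repr_self, P,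
      Finsupp.single_apply, s.f.injective.eq_iff, smul_eq_mul, mul_ite, mul_one, mul_zero,
      Matrix.diagonal_apply]
    by_cases h : i = j
    · simp [h]
    · simp [h, Ne.symm h]
  · intro i h0
    have := s.snf i
    rw [h0, zero_smul] at this
    exact s.bN.ne_zero i (Subtype.ext this)

end PolynomialMatrix

/-! ### Matrix pencils over `k[X]/(X^N)` and substitution of a nilpotent matrix. -/

section TruncatedAction

variable {k : Type*} [Field k] {l m n : Type*}

/-- The matrix `α + X β` over `k[X]`. -/
noncomputable def pencil (α β : Matrix n n k) : Matrix n n k[X] :=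
  α.map C + (X : k[X]) • β.map C

theorem pencil_apply (α β : Matrix n n k) (i j : n) :
    pencil α β i j = C (α i j) + X * C (β i j) := by
  simp [pencil]

theorem pencil_map_eval (α β : Matrix n n k) (c : k) :
    (pencil α β).map (eval c) = α + c • β := by
  ext i j
  simp [pencil_apply, mul_comm c]

theorem pencil_neg_one [DecidableEq n] (γ : Matrix n n k) : pencil
    (-γ) 1 = pencil 0 1 - γ.map C := by
  ext1 i j
  simp [pencil_apply, sub_eq_neg_add]

variable [Fintype n]

/-- A matrix over `k[X]` as a `k`-linear map between free modules over `k[X]/(X^N)`. -/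
noncomputable def truncOp (N : ℕ) (A : Matrix m n k[X]) :
    (n → AdjoinRoot ((X : k[X]) ^ N)) →ₗ[k] (m → AdjoinRoot ((X : k[X]) ^ N)) :=
  (A.map (AdjoinRoot.mk ((X : k[X]) ^ N))).mulVecLin.restrictScalars k

theorem truncOp_apply (N : ℕ) (A : Matrix m n k[X]) (v : n → AdjoinRoot ((X : k[X]) ^ N)) (i : m) :
    truncOp N A v i = ∑ j, AdjoinRoot.mk ((X : k[X]) ^ N) (A i j) * v j := rfl

theorem truncOp_mul [Fintype m] (N : ℕ) (A : Matrix l m k[X]) (B : Matrix m n k[X]) :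
    truncOp N (A * B) = truncOp N A ∘ₗ truncOp N B := by
  refine LinearMap.ext fun v => ?_
  change ((A * B).map (AdjoinRoot.mk ((X : k[X]) ^ N))).mulVec v =
    (A.map (AdjoinRoot.mk ((X : k[X]) ^ N))).mulVec
      ((B.map (AdjoinRoot.mk ((X : k[X]) ^ N))).mulVec v)
  rw [Matrix.map_mul, Matrix.mulVec_mulVec]

theorem truncOp_sub (N : ℕ) (A B : Matrix m n k[X]) :
    truncOp N (A - B) = truncOp N A - truncOp N B := by
  ext v i
  simp [truncOp_apply, sub_mul]

theorem finrank_truncated (N : ℕ) :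
    Module.finrank k (n → AdjoinRoot ((X : k[X]) ^ N)) = Fintype.card n * N := by
  have h := (AdjoinRoot.powerBasis' (monic_X_pow (R := k) N)).finrank
  rw [AdjoinRoot.powerBasis'_dim, natDegree_X_pow] at h
  have : Module.Finite k (AdjoinRoot ((X : k[X]) ^ N)) :=
    (AdjoinRoot.powerBasis' (monic_X_pow (R := k) N)).finite
  rw [Module.finrank_pi_fintype, Finset.sum_const, h, smul_eq_mul, Finset.card_univ]

instance finite_truncated (N : ℕ) : Module.Finite k (AdjoinRoot ((X : k[X]) ^ N)) :=
  (AdjoinRoot.powerBasis' (monic_X_pow (R := k) N)).finite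

/-- The map factors through a free module of rank `R` over `k[X]/(X^N)`. Thus a bound on the rank
over `k[X]` survives truncation, even though the truncated ring has zero divisors. -/
theorem finrank_range_truncOp_mul_le [Fintype m] (N : ℕ) {R : ℕ} (B : Matrix m (Fin R) k[X])
    (C : Matrix (Fin R) n k[X]) :
    Module.finrank k (LinearMap.range (truncOp N (B * C))) ≤ R * N := by
  rw [truncOp_mul]
  refine (Submodule.finrank_mono (LinearMap.range_comp_le_range _ _)).trans ?_
  refine (LinearMap.finrank_range_le _).trans ?_
  rw [finrank_truncated, Fintype.card_fin]

theorem truncOp_commute (N : ℕ) {A B : Matrix n n k[X]} (h : Commute A B) :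
    Commute (truncOp N A : Module.End k _) (truncOp N B) := by
  change truncOp N A ∘ₗ truncOp N B = truncOp N B ∘ₗ truncOp N A
  rw [← truncOp_mul, ← truncOp_mul, h.eq]

theorem Matrix.commute_map_C {α β : Matrix n n k} (h : Commute α β) :
    Commute (α.map C) (β.map C) := by
  change _ = _
  rw [← Matrix.map_mul, ← Matrix.map_mul, h.eq]

/-- The inclusion of the constant vectors `k^n → (k[X]/(X^N))^n`. -/
noncomputable def constVec (n : Type*) (N : ℕ) :
    (n → k) →ₗ[k] (n → AdjoinRoot ((X : k[X]) ^ N)) :=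
  LinearMap.pi fun i => Algebra.linearMap k _ ∘ₗ LinearMap.proj i

theorem constVec_apply {n : Type*} (N : ℕ) (v : n → k) (i : n) :
    constVec n N v i = AdjoinRoot.mk ((X : k[X]) ^ N) (C (v i)) := rfl

theorem truncOp_map_C_constVec (N : ℕ) (γ : Matrix n n k) (v : n → k) :
    truncOp N (γ.map C) (constVec n N v) = constVec n N (γ.mulVec v) := by
  funext i
  simp [truncOp_apply, constVec_apply, Matrix.mulVec, dotProduct]

variable [DecidableEq n]

theorem truncOp_one (N : ℕ) : truncOp N (1 : Matrix n n k[X]) = LinearMap.id := by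
  refine LinearMap.ext fun v => ?_
  change ((1 : Matrix n n k[X]).map (AdjoinRoot.mk ((X : k[X]) ^ N))).mulVec v = v
  rw [Matrix.map_one _ (map_zero _) (map_one _), Matrix.one_mulVec]

theorem truncOp_pow (N : ℕ) (A : Matrix n n k[X]) (j : ℕ) :
    truncOp N (A ^ j) = (truncOp N A : Module.End k _) ^ j := by
  induction j with
  | zero => rw [pow_zero, pow_zero, truncOp_one]; rfl
  | succ j ih => rw [pow_succ, pow_succ, truncOp_mul, ih]; rfl

theorem pencil_commute {α β γ δ : Matrix n n k} (h1 : Commute α γ) (h2 : Commute α δ)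
    (h3 : Commute β γ) (h4 : Commute β δ) : Commute (pencil α β) (pencil γ δ) :=
  ((Matrix.commute_map_C h1).add_right ((Matrix.commute_map_C h2).smul_right _)).add_left
    (((Matrix.commute_map_C h3).add_right ((Matrix.commute_map_C h4).smul_right _)).smul_left _)

/-- Evaluation of truncated polynomials at a nilpotent matrix. -/
noncomputable def truncEval (N : ℕ) (γ : Matrix n n k) :
    AdjoinRoot ((X : k[X]) ^ N) →ₗ[k] Matrix n n k :=
  (aeval γ).toLinearMap ∘ₗ AdjoinRoot.modByMonicHom (monic_X_pow N)

theorem truncEval_mk {N : ℕ} {γ : Matrix n n k} (hγ : γ ^ N = 0) (f : k[X]) :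
    truncEval N γ (AdjoinRoot.mk _ f) = aeval γ f := by
  conv_rhs => rw [← modByMonic_add_div f ((X : k[X]) ^ N)]
  rw [truncEval, LinearMap.comp_apply, AdjoinRoot.modByMonicHom_mk]
  simp [hγ]

/-- The map `(k[X]/(X^N))^n → k^n` evaluating `X` at a nilpotent matrix `γ` of size `n`. -/
noncomputable def evalVec (N : ℕ) (γ : Matrix n n k) :
    (n → AdjoinRoot ((X : k[X]) ^ N)) →ₗ[k] (n → k) :=
  LinearMap.pi fun i => ∑ j, Matrix.entryLinearMap k k i j ∘ₗ truncEval N γ ∘ₗ LinearMap.proj j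

theorem evalVec_apply (N : ℕ) (γ : Matrix n n k) (v : n → AdjoinRoot ((X : k[X]) ^ N)) (i : n) :
    evalVec N γ v i = ∑ j, truncEval N γ (v j) i j := by
  simp [evalVec]

theorem commute_aeval {A : Type*} [Ring A] [Algebra k A] {x y : A} (h : Commute x y) (f : k[X]) :
    Commute (aeval x f) y := by
  induction f using Polynomial.induction_on' with
  | add f g hf hg => rw [map_add]; exact hf.add_left hg
  | monomial n c =>
    rw [aeval_monomial]
    exact (Algebra.commute_algebraMap_left c y).mul_left (h.pow_left n)

/-- `evalVec` sends `∑ f_j e_j` to `∑ f_j(γ) e_j`, so it turns `X` into `γ`. It respects constant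
matrices only when they commute with `γ`; this is where commutativity enters. -/
theorem evalVec_pencil {N : ℕ} {α β γ : Matrix n n k} (hα : Commute γ α) (hβ : Commute γ β)
    (hγ : γ ^ N = 0) (v : n → AdjoinRoot ((X : k[X]) ^ N)) :
    evalVec N γ (truncOp N (pencil α β) v) = (α + γ * β).mulVec (evalVec N γ v) := by
  choose w hw using fun j => AdjoinRoot.mk_surjective (g := (X : k[X]) ^ N) (v j)
  have h1 : ∀ j l, truncEval N γ (AdjoinRoot.mk _ (pencil α β j l) * v l) =
      α j l • aeval γ (w l) + β j l • (aeval γ (w l) * γ) := by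
    intro j l
    rw [← hw, ← map_mul, truncEval_mk hγ, pencil_apply, (commute_aeval (Commute.refl γ) _).eq]
    simp [add_mul, Algebra.smul_def, mul_assoc]
  have h2 : ∀ l, (α + γ * β) * aeval γ (w l) = aeval γ (w l) * α + aeval γ (w l) * γ * β := by
    intro l
    have h := commute_aeval (Commute.refl γ) (w l)
    rw [add_mul, (commute_aeval hα _).eq, mul_assoc γ, ← (commute_aeval hβ _).eq, ← mul_assoc,
      ← h.eq]
  funext i
  rw [evalVec_apply]
  simp only [truncOp_apply, map_sum, h1]
  have h3 : (α + γ * β).mulVec (evalVec N γ v) i =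
      ∑ l, ((α + γ * β) * aeval γ (w l)) i l := by
    simp only [Matrix.mulVec, dotProduct, evalVec_apply, Matrix.mul_apply, Finset.mul_sum]
    rw [Finset.sum_comm]
    simp only [← hw, truncEval_mk hγ]
  rw [h3]
  simp only [h2, Matrix.sum_apply, Matrix.add_apply, Matrix.smul_apply, smul_eq_mul]
  rw [Finset.sum_comm]
  refine Finset.sum_congr rfl fun l _ => ?_
  rw [Finset.sum_add_distrib, Matrix.mul_apply, Matrix.mul_apply (M := aeval γ (w l) * γ)]
  simp only [mul_comm]

theorem evalVec_constVec {N : ℕ} {γ : Matrix n n k} (hγ : γ ^ N = 0) (v : n → k) :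
    evalVec N γ (constVec n N v) = v := by
  funext i
  rw [evalVec_apply]
  simp only [constVec_apply, truncEval_mk hγ, aeval_C, Matrix.algebraMap_matrix_apply]
  simp

theorem truncOp_X_apply (N : ℕ) (v : n → AdjoinRoot ((X : k[X]) ^ N)) (i : n) :
    truncOp N (pencil (0 : Matrix n n k) 1) v i = AdjoinRoot.mk _ X * v i := by
  rw [truncOp_apply, Finset.sum_eq_single i]
  · simp [pencil_apply]
  · intro j _ hj
    simp [pencil_apply, Matrix.one_apply_ne hj.symm]
  · simp

theorem truncOp_X_pow_apply (N j : ℕ) (v : n → AdjoinRoot ((X : k[X]) ^ N)) (i : n) :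
    (truncOp N (pencil (0 : Matrix n n k) 1) ^ j : Module.End k _) v i =
      AdjoinRoot.mk _ (X ^ j) * v i := by
  induction j generalizing v with
  | zero => simp
  | succ j ih =>
    rw [pow_succ, Module.End.mul_apply, ih, truncOp_X_apply, ← mul_assoc, ← map_mul, pow_succ]

theorem evalVec_X_pow {N : ℕ} {γ : Matrix n n k} (hγ : γ ^ N = 0) (i : ℕ)
    (v : n → AdjoinRoot ((X : k[X]) ^ N)) :
    evalVec N γ ((truncOp N (pencil (0 : Matrix n n k) 1) ^ i : Module.End k _) v) =
      (γ ^ i).mulVec (evalVec N γ v) := by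
  induction i generalizing v with
  | zero => simp
  | succ i ih =>
    rw [pow_succ, Module.End.mul_apply, ih,
      evalVec_pencil (Commute.zero_right γ) (Commute.one_right γ) hγ, Matrix.mulVec_mulVec]
    simp [pow_succ]

/-- Modulo `X - γ` one may replace `X^i c` by `γ^i c`, because `X - γ` divides `X^i - γ^i`. By
linearity monomial vectors suffice. -/
theorem sub_constVec_evalVec_mem {N : ℕ} {γ : Matrix n n k} (hγ : γ ^ N = 0)
    (v : n → AdjoinRoot ((X : k[X]) ^ N)) :
    v - constVec n N (evalVec N γ v) ∈ LinearMap.range (truncOp N (pencil (-γ) 1)) := by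
  set Z : Module.End k (n → AdjoinRoot ((X : k[X]) ^ N)) := truncOp N (pencil 0 1) with hZdef
  have hZ : Commute (pencil (0 : Matrix n n k) 1) (γ.map C) := by
    have : pencil γ 0 = γ.map C := by ext1 i j; simp [pencil_apply]
    rw [← this]
    exact pencil_commute (Commute.zero_left _) (Commute.zero_left _) (Commute.one_left _)
      (Commute.one_left _)
  have hpow : ∀ i : ℕ, ∀ c : n → k, (Z ^ i) (constVec n N c) -
      constVec n N ((γ ^ i).mulVec c) ∈ LinearMap.range (truncOp N (pencil (-γ) 1)) := by
    intro i c
    have h1 : (γ ^ i).map C = (γ.map C) ^ i := Matrix.map_pow γ (C : k →+* k[X]) i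
    rw [← truncOp_map_C_constVec, h1, hZdef, ← truncOp_pow, ← LinearMap.sub_apply, ← truncOp_sub]
    obtain ⟨Y, hY⟩ := hZ.sub_dvd_pow_sub_pow i
    rw [hY, pencil_neg_one, truncOp_mul]
    exact ⟨_, rfl⟩
  let Φ : Module.End k (n → AdjoinRoot ((X : k[X]) ^ N)) :=
    LinearMap.id - constVec n N ∘ₗ evalVec N γ
  suffices h : ∀ v, Φ v ∈ LinearMap.range (truncOp N (pencil (-γ) 1)) from h v
  have hmon : ∀ (i : ℕ) (c : n → k),
      Φ ((Z ^ i) (constVec n N c)) ∈ LinearMap.range (truncOp N (pencil (-γ) 1)) := by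
    intro i c
    have := hpow i c
    have h1 : evalVec N γ ((Z ^ i) (constVec n N c)) = (γ ^ i).mulVec c := by
      rw [hZdef, evalVec_X_pow hγ, evalVec_constVec hγ]
    rwa [← h1] at this
  have hpoly : ∀ (j : n) (f : k[X]), Φ (Pi.single j (AdjoinRoot.mk _ f)) ∈
      LinearMap.range (truncOp N (pencil (-γ) 1)) := by
    intro j f
    induction f using Polynomial.induction_on' with
    | add f g hf hg =>
      rw [map_add, Pi.single_add, map_add]
      exact Submodule.add_mem _ hf hg
    | monomial i c =>
      have := hmon i (Pi.single j c)
      convert this using 2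
      funext l
      rw [hZdef, truncOp_X_pow_apply, constVec_apply, ← map_mul]
      by_cases h : l = j
      · subst h
        simp only [Pi.single_eq_same]
        rw [← C_mul_X_pow_eq_monomial, mul_comm]
      · simp [h]
  intro v
  rw [← Finset.univ_sum_single v, map_sum]
  refine Submodule.sum_mem _ fun j _ => ?_
  obtain ⟨f, hf⟩ := AdjoinRoot.mk_surjective (v j)
  rw [← hf]
  exact hpoly j f

/-- Together with surjectivity, this presents `k^n`, with `X` acting as `γ`, as the cokernel of `X -
γ`. -/
theorem ker_evalVec {N : ℕ} {γ : Matrix n n k} (hγ : γ ^ N = 0) :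
    LinearMap.ker (evalVec N γ) = LinearMap.range (truncOp N (pencil (-γ) 1)) := by
  apply le_antisymm
  · intro v hv
    have h := sub_constVec_evalVec_mem hγ v
    rwa [LinearMap.mem_ker.1 hv, map_zero, sub_zero] at h
  · rintro _ ⟨v, rfl⟩
    rw [LinearMap.mem_ker, evalVec_pencil (Commute.refl γ).neg_right (Commute.one_right γ) hγ]
    simp

/-- `X` and `γ` commute, so in characteristic `p` the power `(X - γ)^(p^e)` is `X^(p^e) - γ^(p^e)`.
This is how characteristic `p` enters the rank comparison. -/
theorem pencil_neg_one_pow (p : ℕ) [Fact p.Prime] [CharP k p] (γ : Matrix n n k) (e : ℕ)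
    (hγ : γ ^ p ^ e = 0) : pencil (-γ) 1 ^ p ^ e = pencil 0 1 ^ p ^ e := by
  rcases subsingleton_or_nontrivial (Matrix n n k[X]) with h | h
  · exact Subsingleton.elim _ _
  · have : CharP (Matrix n n k[X]) p :=
      charP_of_injective_algebraMap (algebraMap k (Matrix n n k[X])).injective p
    have hZ : Commute (pencil (0 : Matrix n n k) 1) (γ.map C) := by
      have : pencil γ 0 = γ.map C := by ext1 i j; simp [pencil_apply]
      rw [← this]
      exact pencil_commute (Commute.zero_left _) (Commute.zero_left _) (Commute.one_left _)
        (Commute.one_left _)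
    have h1 : (γ.map C) ^ p ^ e = (γ ^ p ^ e).map C := (Matrix.map_pow γ (C : k →+* k[X]) _).symm
    rw [pencil_neg_one, sub_pow_char_pow_of_commute p e hZ, h1, hγ]
    ext1 i j
    simp

/-- For `γ` commuting with `α` and `β`, the cokernel of `(α + γβ)^j` is the kernel of `X - γ` on
the cokernel of `(α + Xβ)^j`. -/
theorem finrank_ker_cokerMap_pencil {N : ℕ} {α β γ : Matrix n n k} (hα : Commute γ α)
    (hβ : Commute γ β) (hγ : γ ^ N = 0) (j : ℕ)
    (h : Commute (truncOp N (pencil α β ^ j) : Module.End k _) (truncOp N (pencil (-γ) 1))) :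
    Module.finrank k (LinearMap.ker (cokerMap h)) + ((α + γ * β) ^ j).rank = Fintype.card n := by
  have hE : Function.Surjective (evalVec N γ) := fun v => ⟨_, evalVec_constVec hγ v⟩
  have hP : evalVec N γ ∘ₗ truncOp N (pencil α β ^ j) =
      ((α + γ * β) ^ j).mulVecLin ∘ₗ evalVec N γ := by
    refine LinearMap.ext fun v => ?_
    rw [LinearMap.comp_apply, LinearMap.comp_apply, Matrix.mulVecLin_apply]
    clear h
    induction j generalizing v with
    | zero => simp [truncOp_one]
    | succ j ih =>
      rw [pow_succ', truncOp_mul, LinearMap.comp_apply, evalVec_pencil hα hβ hγ,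
        ih, Matrix.mulVec_mulVec, pow_succ']
  have := finrank_ker_cokerMap h hE (ker_evalVec hγ) hP
  rwa [Module.finrank_fintype_fun_eq_card] at this

/-- The key rank lemma. `R` is the rank of the pencil's `j`-th power over `k[X]`, and scalars and
commuting nilpotent matrices are treated as two kinds of specialization of `X`. -/
theorem Matrix.exists_generic_rank_pencil (p : ℕ) [Fact p.Prime] [CharP k p] (α β : Matrix n n k)
    (j : ℕ) :
    ∃ R : ℕ, (∀ c : k, ((α + c • β) ^ j).rank ≤ R) ∧ {c : k | ((α + c • β) ^ j).rank ≠ R}.Finite ∧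
      ∀ (γ : Matrix n n k) (e : ℕ), Commute γ α → Commute γ β → γ ^ p ^ e = 0 →
        ((α + γ * β) ^ j).rank ≤ R ∧ ((α ^ j).rank = R → ((α + γ * β) ^ j).rank = R) := by
  obtain ⟨R, B, C', P, Q, a, hBC, hPQ, ha⟩ := Matrix.exists_rank_factorization (pencil α β ^ j)
  have heval : ∀ c : k, (α + c • β) ^ j = (pencil α β ^ j).map (evalRingHom c) := fun c => by
    rw [Matrix.map_pow]
    exact congrArg (· ^ j) (pencil_map_eval α β c).symm
  have hle : ∀ c : k, ((α + c • β) ^ j).rank ≤ R := by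
    intro c
    rw [heval, hBC, Matrix.map_mul]
    refine (Matrix.rank_mul_le_left _ _).trans ((Matrix.rank_le_card_width _).trans ?_)
    rw [Fintype.card_fin]
  refine ⟨R, hle, ?_, ?_⟩
  -- Away from the roots of the diagonal entries `a i`, the specialized matrix still has a
  -- nonsingular diagonal `R × R` matrix as a two-sided multiple.
  · refine Set.Finite.subset
      (Set.finite_iUnion fun i => (a i).rootSet_finite k) fun c hc => ?_
    by_contra hcon
    simp only [Set.mem_iUnion, not_exists, mem_rootSet, not_and] at hcon
    refine hc (le_antisymm (hle c) ?_)
    have h1 : (Matrix.diagonal fun i => eval c (a i)) =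
        P.map (evalRingHom c) * (α + c • β) ^ j * Q.map (evalRingHom c) := by
      rw [heval, ← Matrix.map_mul, ← Matrix.map_mul, hPQ]
      ext i l
      by_cases hil : i = l <;> simp [hil]
    have h2 : (Matrix.diagonal fun i => eval c (a i)).rank = R := by
      classical
      rw [Matrix.rank_diagonal]
      have : ∀ i, eval c (a i) ≠ 0 := fun i => by simpa using hcon i (ha i)
      simp [this]
    rw [← h2, h1]
    exact (Matrix.rank_mul_le_left _ _).trans (Matrix.rank_mul_le_right _ _)
  · intro γ e hα hβ hγ
    set q := p ^ e with hq
    have hq0 : 0 < q := pow_pos (Fact.out : p.Prime).pos e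
    -- Truncation at `2q` rather than `q`: modulo `X^q` the common power `X^q = (X - γ)^q` would
    -- vanish and retain nothing about freeness.
    have hγN : γ ^ (2 * q) = 0 := by rw [two_mul, pow_add, hγ, zero_mul]
    have hcf : Commute (truncOp (2 * q) (pencil α β ^ j) : Module.End k _)
        (truncOp (2 * q) (pencil (-γ) 1)) :=
      truncOp_commute _ ((pencil_commute hα.symm.neg_right (Commute.one_right _)
        hβ.symm.neg_right (Commute.one_right _)).pow_left _)
    have hcs : Commute (truncOp (2 * q) (pencil α β ^ j) : Module.End k _)
        (truncOp (2 * q) (pencil (-0) 1)) :=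
      truncOp_commute _ ((pencil_commute (Commute.zero_right _).neg_right (Commute.one_right _)
        (Commute.zero_right _).neg_right (Commute.one_right _)).pow_left _)
    have hf := finrank_ker_cokerMap_pencil hα hβ hγN j hcf
    have hs := finrank_ker_cokerMap_pencil (Commute.zero_left α) (Commute.zero_left β)
      (zero_pow (by omega)) j hcs
    rw [zero_mul, add_zero] at hs
    have hpows : (truncOp (2 * q) (pencil (-0 : Matrix n n k) 1) ^ (2 * q) : Module.End k _) = 0 := by
      refine LinearMap.ext fun v => funext fun i => ?_
      rw [neg_zero, truncOp_X_pow_apply, AdjoinRoot.mk_self, zero_mul]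
      rfl
    have hpowfs : (truncOp (2 * q) (pencil (-γ) 1) ^ q : Module.End k _) =
        truncOp (2 * q) (pencil (-0 : Matrix n n k) 1) ^ q := by
      rw [← truncOp_pow, ← truncOp_pow, pencil_neg_one_pow p γ e hγ, neg_zero]
    have hpowf : (truncOp (2 * q) (pencil (-γ) 1) ^ (2 * q) : Module.End k _) = 0 :=
      (pow_mul' _ _ _).trans (by rw [hpowfs, ← pow_mul', hpows])
    have hC := Submodule.finrank_quotient_add_finrank
      (LinearMap.range (truncOp (2 * q) (pencil α β ^ j)))
    rw [finrank_truncated] at hC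
    have hrk : Module.finrank k (LinearMap.range (truncOp (2 * q) (pencil α β ^ j))) ≤
        R * (2 * q) := by
      rw [hBC]
      exact finrank_range_truncOp_mul_le _ _ _
    have h1 := finrank_le_mul_finrank_ker (cokerMap_pow_eq_zero hcf hpowf)
    have h2 := finrank_le_mul_finrank_ker (cokerMap_pow_eq_zero hcs hpows)
    -- With `C` the cokernel of the truncated pencil power, `2q(n - R) ≤ dim C ≤ 2q · dim ker(X -
    -- γ)`.
    have hA : ((α + γ * β) ^ j).rank ≤ R := by
      have : Fintype.card n * (2 * q) ≤
          (R + Module.finrank k (LinearMap.ker (cokerMap hcf))) * (2 * q) := by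
        rw [add_mul, mul_comm (Module.finrank k _) (2 * q)]
        omega
      have := Nat.le_of_mul_le_mul_right this (by omega)
      omega
    refine ⟨hA, fun hR => ?_⟩
    -- When `α^j` has rank `R`, the kernel of `X` on `C` has dimension `n - R`, so `dim C` attains
    -- the bound for `X` and `C` is free over `k[X]/(X^(2q))`.
    have h3 : Module.finrank k (LinearMap.ker (cokerMap hcf)) =
        Module.finrank k (LinearMap.ker (cokerMap hcs)) := by
      refine finrank_ker_eq_of_pow_eq hq0 (cokerMap_pow_eq_pow hcf hcs hpowfs)
        (cokerMap_pow_eq_zero hcs hpows) (le_antisymm h2 ?_)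
      rw [← hs, hR, add_mul, mul_comm (Module.finrank k _) (2 * q)] at hC
      omega
    omega

end TruncatedAction

/-! ## Ranks of powers in commutative algebras of endomorphisms -/

section PowRank

variable {k : Type*} [Field k] {M : Type*} [AddCommGroup M] [Module k M]

/-- The rank of the `j`-th power of an endomorphism. -/
noncomputable def powRank (φ : Module.End k M) (j : ℕ) : ℕ :=
  Module.finrank k (LinearMap.range (φ ^ j))

variable [FiniteDimensional k M]

theorem powRank_le (φ : Module.End k M) (j : ℕ) : powRank φ j ≤ Module.finrank k M :=
  Submodule.finrank_le _

theorem exists_generic_powRank (p : ℕ) [Fact p.Prime] [CharP k p] (α β : Module.End k M) (j : ℕ) :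
    ∃ R : ℕ, (∀ c : k, powRank (α + c • β) j ≤ R) ∧ {c : k | powRank (α + c • β) j ≠ R}.Finite ∧
      ∀ γ : Module.End k M, IsNilpotent γ → Commute γ α → Commute γ β →
        powRank (α + γ * β) j ≤ R ∧ (powRank α j = R → powRank (α + γ * β) j = R) := by
  let b := Module.finBasis k M
  let e := LinearMap.toMatrixAlgEquiv b
  have he : ∀ φ : Module.End k M, powRank φ j = (e φ ^ j).rank := by
    intro φ
    rw [← map_pow, Matrix.rank_eq_finrank_range_toLin _ b b]
    have : Matrix.toLin b b (e (φ ^ j)) = φ ^ j := Matrix.toLin_toMatrix b b (φ ^ j)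
    rw [this, powRank]
  obtain ⟨R, h1, h2, h3⟩ := Matrix.exists_generic_rank_pencil p (e α) (e β) j
  refine ⟨R, fun c => ?_, ?_, fun γ hγ hα hβ => ?_⟩
  · rw [he, map_add, map_smul]
    exact h1 c
  · simpa only [he, map_add, map_smul] using h2
  · obtain ⟨n, hn⟩ := hγ
    have hn' : e γ ^ p ^ n = 0 := by
      rw [← map_pow, pow_eq_zero_of_le (Nat.lt_pow_self (Fact.out : p.Prime).one_lt).le hn, map_zero]
    simpa only [he, map_add, map_mul] using h3 (e γ) n (hα.map e) (hβ.map e) hn'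

/-- Finitely many rank conditions can be maximized simultaneously on a linear space. -/
theorem exists_forall_powRank_le [Infinite k] (p : ℕ) [Fact p.Prime] [CharP k p]
    (W : Submodule k (Module.End k M)) (N : ℕ) :
    ∃ w ∈ W, ∀ x ∈ W, ∀ j < N, powRank x j ≤ powRank w j := by
  let S : Set ℕ := {s | ∃ w ∈ W, s = ∑ j ∈ Finset.range N, powRank w j}
  have hne : S.Nonempty := ⟨_, 0, W.zero_mem, rfl⟩
  have hbdd : BddAbove S := by
    refine ⟨∑ j ∈ Finset.range N, Module.finrank k M, ?_⟩
    rintro _ ⟨w, -, rfl⟩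
    exact Finset.sum_le_sum fun j _ => powRank_le w j
  -- `w` maximizes the sum of the ranks. If some `x` beat it in one rank, a generic point of the
  -- line through `w` and `x` would have every rank at least that of `w` and one strictly larger.
  obtain ⟨w, hw, hwS⟩ := Nat.sSup_mem hne hbdd
  refine ⟨w, hw, fun x hx i hi => ?_⟩
  by_contra! hlt
  choose R h1 h2 h3 using fun j => exists_generic_powRank p w (x - w) j
  obtain ⟨c, hc⟩ := (Set.Finite.biUnion (Finset.range N).finite_toSet
    fun j _ => h2 j).infinite_compl.nonempty
  simp only [Set.mem_compl_iff, Set.mem_iUnion, not_exists, Set.mem_ofPred_eq, not_not,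
    Finset.mem_coe, Finset.mem_range] at hc
  have hw0 : ∀ j, powRank w j ≤ R j := fun j => by simpa using h1 j 0
  have hx0 : ∀ j, powRank x j ≤ R j := fun j => by simpa using h1 j 1
  have hlt' : ∑ j ∈ Finset.range N, powRank w j <
      ∑ j ∈ Finset.range N, powRank (w + c • (x - w)) j := by
    refine Finset.sum_lt_sum (fun j hj => ?_) ⟨i, Finset.mem_range.2 hi, ?_⟩
    · rw [hc j (Finset.mem_range.1 hj)]
      exact hw0 j
    · rw [hc i hi]
      exact hlt.trans_le (hx0 i)
  rw [← hwS] at hlt'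
  exact absurd (le_csSup hbdd ⟨_, W.add_mem hw (W.smul_mem c (W.sub_mem hx hw)), rfl⟩) hlt'.not_ge

variable {A : Type*} [CommRing A] [Algebra k A] (θ : A →ₐ[k] Module.End k M) {ι : Type*}

/-- A nilpotent coefficient does no better than a generic scalar one. -/
theorem exists_powRank_add_mul_le [Infinite k] (p : ℕ) [Fact p.Prime] [CharP k p] (α β γ : A)
    (hγ : IsNilpotent γ) (j : ℕ) :
    ∃ c : k, powRank (θ (α + γ * β)) j ≤ powRank (θ (α + c • β)) j := by
  obtain ⟨R, -, h2, h3⟩ := exists_generic_powRank p (θ α) (θ β) j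
  obtain ⟨c, hc⟩ := h2.infinite_compl.nonempty
  simp only [Set.mem_compl_iff, Set.mem_ofPred_eq, not_not] at hc
  refine ⟨c, ?_⟩
  rw [map_add, map_mul, map_add, map_smul, hc]
  exact (h3 (θ γ) (hγ.map θ) ((Commute.all γ α).map θ) ((Commute.all γ β).map θ)).1

/-- Maximality of `α` on the line `α + kβ` means that its rank is the generic one, so the equality
case of the key lemma applies. -/
theorem powRank_add_mul_eq [Infinite k] (p : ℕ) [Fact p.Prime] [CharP k p] (α β γ : A)
    (hγ : IsNilpotent γ) (j : ℕ)
    (h : ∀ c : k, powRank (θ (α + c • β)) j ≤ powRank (θ α) j) :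
    powRank (θ (α + γ * β)) j = powRank (θ α) j := by
  obtain ⟨R, h1, h2, h3⟩ := exists_generic_powRank p (θ α) (θ β) j
  obtain ⟨c, hc⟩ := h2.infinite_compl.nonempty
  simp only [Set.mem_compl_iff, Set.mem_ofPred_eq, not_not] at hc
  have hR : powRank (θ α) j = R := by
    refine le_antisymm (by simpa using h1 0) ?_
    rw [← hc, ← map_smul, ← map_add]
    exact h c
  rw [map_add, map_mul, hR]
  exact (h3 (θ γ) (hγ.map θ) ((Commute.all γ α).map θ) ((Commute.all γ β).map θ)).2 hR

theorem exists_powRank_add_sum_le [Infinite k] (p : ℕ) [Fact p.Prime] [CharP k p] (α : A)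
    (β γ : ι → A) (hγ : ∀ i, IsNilpotent (γ i)) (s : Finset ι) (j : ℕ) :
    ∃ c : ι → k, powRank (θ (α + ∑ i ∈ s, γ i * β i)) j ≤
      powRank (θ (α + ∑ i ∈ s, c i • β i)) j := by
  classical
  induction s using Finset.induction_on generalizing α with
  | empty => exact ⟨0, by simp⟩
  | insert a s ha ih =>
    obtain ⟨t, ht⟩ := exists_powRank_add_mul_le θ p (α + ∑ i ∈ s, γ i * β i) (β a) (γ a) (hγ a) j
    -- The scalar replacing `γ a` is absorbed into the base point before the remaining coefficients
    -- are replaced.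
    obtain ⟨c, hc⟩ := ih (α + t • β a)
    refine ⟨Function.update c a t, ?_⟩
    rw [Finset.sum_insert ha, Finset.sum_insert ha, Function.update_self]
    have h1 : ∑ i ∈ s, Function.update c a t i • β i = ∑ i ∈ s, c i • β i :=
      Finset.sum_congr rfl fun i hi => by
        rw [Function.update_of_ne (ne_of_mem_of_not_mem hi ha)]
    rw [h1, add_comm (γ a * β a), ← add_assoc, ← add_assoc]
    refine ht.trans ?_
    rw [add_right_comm]
    exact hc

/-- If the rank of `α^j` is maximal in `α + ∑ k β_i`, then it does not change when an element of
`∑ 𝔫 β_i` is added to `α`, where `𝔫` is the nilradical. -/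
theorem powRank_add_sum_eq [Infinite k] (p : ℕ) [Fact p.Prime] [CharP k p] (α : A)
    (β γ : ι → A) (hγ : ∀ i, IsNilpotent (γ i)) (s : Finset ι) (j : ℕ)
    (h : ∀ c : ι → k, powRank (θ (α + ∑ i ∈ s, c i • β i)) j ≤ powRank (θ α) j) :
    powRank (θ (α + ∑ i ∈ s, γ i * β i)) j = powRank (θ α) j := by
  classical
  induction s using Finset.induction_on generalizing α with
  | empty => simp
  | insert a s ha ih =>
    have hup : ∀ (c : ι → k) (t : k), ∑ i ∈ insert a s, Function.update c a t i • β i =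
        t • β a + ∑ i ∈ s, c i • β i := by
      intro c t
      rw [Finset.sum_insert ha, Function.update_self]
      congr 1
      exact Finset.sum_congr rfl fun i hi => by
        rw [Function.update_of_ne (ne_of_mem_of_not_mem hi ha)]
    have h1 : powRank (θ (α + γ a * β a)) j = powRank (θ α) j := by
      refine powRank_add_mul_eq θ p α (β a) (γ a) (hγ a) j fun t => ?_
      have := h (Function.update 0 a t)
      rw [hup] at this
      simpa using this
    rw [Finset.sum_insert ha, ← add_assoc, ih (α + γ a * β a), h1]
    -- The induction needs `α + γ a * β a` to be maximal in the remaining directions. A competitor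
    -- is dominated by one with a scalar `t` in place of `γ a`, which the original maximality
    -- bounds.
    intro c
    obtain ⟨t, ht⟩ := exists_powRank_add_mul_le θ p (α + ∑ i ∈ s, c i • β i) (β a) (γ a) (hγ a) j
    rw [h1, add_right_comm]
    refine ht.trans ?_
    have := h (Function.update c a t)
    rwa [hup, add_comm (t • β a), ← add_assoc] at this

end PowRank

/-! ## Jordan types and ranks -/

section JordanRank

variable {k : Type u} [Field k] {V : Type v} [AddCommGroup V] [Module k V]

theorem hasJordanType_jordanType [FiniteDimensional k V] {φ : Module.End k V} (hφ : IsNilpotent φ) :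
    HasJordanType φ (jordanType φ) :=
  (hasJordanType_iff hφ _).2 rfl

theorem HasJordanType.apply_eq_zero_of_pow_eq_zero [FiniteDimensional k V] {φ : Module.End k V}
    {c : ℕ → ℕ}
    (h : HasJordanType φ c) {p : ℕ} (hp : φ ^ p = 0) {i : ℕ} (hi : p < i) : c i = 0 := by
  have h1 := h.finrank_range_pow p (Module.finrank k V + i) (Nat.le_add_right _ _)
  rw [finrank_range_eq_zero hp, eq_comm, Finset.sum_eq_zero_iff] at h1
  have h2 := h1 i (Finset.mem_Icc.2 ⟨hi.le, Nat.le_add_left _ _⟩)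
  rcases mul_eq_zero.1 h2 with h3 | h3
  · omega
  · exact h3

/-- A block of size `i` contributes `i - j` to the rank of `φ^j`, and blocks larger than `p` do not
occur. So the sums defining `JordanLE` are ranks of powers. -/
theorem sum_jordanType_eq_powRank [FiniteDimensional k V] {φ : Module.End k V} {p : ℕ}
    (hp : φ ^ p = 0) (j : ℕ) :
    ∑ i ∈ Finset.Icc j p, (i - j) * jordanType φ i = powRank φ j := by
  have h := hasJordanType_jordanType ⟨p, hp⟩
  rw [powRank, h.finrank_range_pow j (p + Module.finrank k V) (Nat.le_add_left _ _)]
  refine Finset.sum_subset (Finset.Icc_subset_Icc_right (Nat.le_add_right _ _)) fun i hi hi' => ?_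
  rw [Finset.mem_Icc] at hi hi'
  rw [h.apply_eq_zero_of_pow_eq_zero hp (by omega), mul_zero]

theorem jordanLE_jordanType_iff [FiniteDimensional k V] {φ ψ : Module.End k V} {p : ℕ}
    (hφ : φ ^ p = 0) (hψ : ψ ^ p = 0) :
    JordanLE p (jordanType φ) (jordanType ψ) ↔ ∀ j, powRank φ j ≤ powRank ψ j := by
  simp only [JordanLE, sum_jordanType_eq_powRank hφ, sum_jordanType_eq_powRank hψ]

theorem HasJordanType.add_two_mul_powRank [FiniteDimensional k V] {φ : Module.End k V} {c : ℕ → ℕ}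
    (h : HasJordanType φ c) (i : ℕ) :
    c (i + 1) + 2 * powRank φ (i + 1) = powRank φ i + powRank φ (i + 2) := by
  set N := Module.finrank k V + i + 2 with hN
  have hNV : Module.finrank k V ≤ N := by omega
  simp only [powRank]
  rw [h.finrank_range_pow _ N hNV, h.finrank_range_pow _ N hNV, h.finrank_range_pow _ N hNV]
  have split : ∀ (a : ℕ) (_ : a ≤ N) (g : ℕ → ℕ),
      ∑ x ∈ Finset.Icc a N, g x = g a + ∑ x ∈ Finset.Icc (a + 1) N, g x := by
    intro a ha g
    rw [← Finset.add_sum_Ioc_eq_sum_Icc ha, Finset.Icc_add_one_left_eq_Ioc]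
  rw [split i (by omega) (fun x => (x - i) * c x),
    split (i + 1) (by omega) (fun x => (x - i) * c x),
    split (i + 1) (by omega) (fun x => (x - (i + 1)) * c x)]
  have : ∑ x ∈ Finset.Icc (i + 1 + 1) N, (x - i) * c x +
      ∑ x ∈ Finset.Icc (i + 2) N, (x - (i + 2)) * c x =
      2 * ∑ x ∈ Finset.Icc (i + 1 + 1) N, (x - (i + 1)) * c x := by
    rw [← Finset.sum_add_distrib, Finset.mul_sum]
    refine Finset.sum_congr rfl fun x hx => ?_
    obtain ⟨y, rfl⟩ := Nat.exists_eq_add_of_le (Finset.mem_Icc.1 hx).1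
    rw [show i + 1 + 1 + y - i = y + 2 by omega, show i + 1 + 1 + y - (i + 2) = y by omega,
      show i + 1 + 1 + y - (i + 1) = y + 1 by omega]
    ring
  simp only [Nat.sub_self, zero_mul, zero_add, Nat.add_sub_cancel_left, one_mul]
  linarith

/-- Multiplicities are second differences of the ranks of powers. -/
theorem jordanType_eq_of_powRank_eq [FiniteDimensional k V] {φ ψ : Module.End k V}
    (hφ : IsNilpotent φ)
    (hψ : IsNilpotent ψ) (h : ∀ j, powRank φ j = powRank ψ j) : jordanType φ = jordanType ψ := by
  have h1 := hasJordanType_jordanType hφ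
  have h2 := hasJordanType_jordanType hψ
  funext i
  rcases i with _ | i
  · rw [h1.1, h2.1]
  · have h3 := h1.add_two_mul_powRank i
    have h4 := h2.add_two_mul_powRank i
    simp only [h] at h3
    omega

/-! ## Freeness over truncated polynomial rings -/

theorem finrank_quotient_X_pow (p : ℕ) :
    Module.finrank k (k[X] ⧸ Ideal.span {(X : k[X]) ^ p}) = p := by
  have h := (AdjoinRoot.powerBasis' (monic_X_pow (R := k) p)).finrank
  rw [AdjoinRoot.powerBasis'_dim, natDegree_X_pow] at h
  exact h

theorem IsFreeTruncated.pow_eq_zero {p : ℕ} {φ : Module.End k V} (h : IsFreeTruncated p φ) :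
    φ ^ p = 0 := by
  obtain ⟨ι, ⟨e⟩⟩ := h
  refine LinearMap.ext fun v => (Module.AEval'.of φ).injective (e.injective ?_)
  have h1 : Module.AEval'.of φ ((φ ^ p) v) = (X ^ p : k[X]) • Module.AEval'.of φ v := by
    rw [← Module.AEval.of_aeval_smul]
    simp [Module.End.smul_def]
  rw [LinearMap.zero_apply, map_zero, map_zero, h1, map_smul]
  ext i
  obtain ⟨f, hf⟩ := Ideal.Quotient.mk_surjective (e (Module.AEval'.of φ v) i)
  rw [Finsupp.smul_apply, ← hf]
  change Ideal.Quotient.mk _ (X ^ p * f) = 0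
  exact Ideal.Quotient.eq_zero_iff_mem.2 (Ideal.mul_mem_right _ _ (Ideal.mem_span_singleton_self _))

/-- In `k[X]/(X^p)` every element killed by `X` is divisible by `X^(p-1)`; this is applied
coordinatewise. -/
theorem IsFreeTruncated.ker_le {p : ℕ} (hp : 0 < p) {φ : Module.End k V}
    (h : IsFreeTruncated p φ) : LinearMap.ker φ ≤ LinearMap.range (φ ^ (p - 1)) := by
  obtain ⟨ι, ⟨e⟩⟩ := h
  intro v hv
  have h1 : (X : k[X]) • e (Module.AEval'.of φ v) = 0 := by
    rw [← map_smul, Module.AEval'.X_smul_of, LinearMap.mem_ker.1 hv, map_zero, map_zero]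
  have h2 : ∀ i, ∃ g : k[X] ⧸ Ideal.span {(X : k[X]) ^ p},
      e (Module.AEval'.of φ v) i = (X ^ (p - 1) : k[X]) • g := by
    intro i
    obtain ⟨f, hf⟩ := Ideal.Quotient.mk_surjective (e (Module.AEval'.of φ v) i)
    have h3 := DFunLike.congr_fun h1 i
    rw [Finsupp.smul_apply, ← hf] at h3
    change Ideal.Quotient.mk _ (X * f) = 0 at h3
    rw [Ideal.Quotient.eq_zero_iff_mem, Ideal.mem_span_singleton, ← Nat.sub_add_cancel hp,
      pow_succ', mul_dvd_mul_iff_left X_ne_zero] at h3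
    obtain ⟨g, rfl⟩ := h3
    exact ⟨Ideal.Quotient.mk _ g, hf.symm⟩
  choose g hg using h2
  set w := e (Module.AEval'.of φ v) with hw
  have h4 : w = (X ^ (p - 1) : k[X]) • ∑ i ∈ w.support, Finsupp.single i (g i) := by
    conv_lhs => rw [← Finsupp.sum_single w, Finsupp.sum]
    rw [Finset.smul_sum]
    refine Finset.sum_congr rfl fun i _ => ?_
    rw [Finsupp.smul_single, ← hg]
  obtain ⟨y, hy⟩ := e.surjective (∑ i ∈ w.support, Finsupp.single i (g i))
  obtain ⟨z, rfl⟩ := (Module.AEval'.of φ).surjective y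
  refine ⟨z, (Module.AEval'.of φ).injective (e.injective ?_)⟩
  rw [← hw, h4, ← hy, ← map_smul]
  congr 1
  rw [← Module.AEval.of_aeval_smul]
  simp [Module.End.smul_def]

theorem IsFreeTruncated.finrank_eq [FiniteDimensional k V] {p : ℕ} (hp : 0 < p) {φ : Module.End k V}
    (h : IsFreeTruncated p φ) : Module.finrank k V = p * Module.finrank k (LinearMap.ker φ) := by
  have h0 := h.pow_eq_zero
  refine le_antisymm (finrank_le_mul_finrank_ker h0) ?_
  have h1 := add_le_finrank_range_pow φ 0 (p - 1)
  have h2 := finrank_range_pow_eq φ (p - 1)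
  rw [Nat.sub_add_cancel hp, finrank_range_eq_zero h0, inf_eq_left.2 (h.ker_le hp)] at h2
  rw [zero_add, inf_eq_left.2 (h.ker_le hp), finrank_range_pow_zero, h2, zero_add] at h1
  obtain ⟨m, rfl⟩ : ∃ m, p = m + 1 := ⟨p - 1, by omega⟩
  rw [add_one_mul]
  rw [Nat.add_sub_cancel] at h1
  omega

/-- Lifting a basis of `coker φ` gives a map from a free module which is onto by nilpotency of `φ`.
The hypothesis makes both dimensions equal, so the map is an isomorphism. -/
theorem isFreeTruncated_of_finrank_eq [FiniteDimensional k V] {p : ℕ} {φ : Module.End k V}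
    (h0 : φ ^ p = 0)
    (h : Module.finrank k V = p * Module.finrank k (LinearMap.ker φ)) : IsFreeTruncated p φ := by
  let b := Module.finBasis k (V ⧸ LinearMap.range φ)
  choose m hm using fun i => Submodule.mkQ_surjective (LinearMap.range φ) (b i)
  let ι := ULift.{v} (Fin (Module.finrank k (V ⧸ LinearMap.range φ)))
  have hX : ∀ y : Module.AEval' φ, (X ^ p : k[X]) • y = 0 := by
    intro y
    obtain ⟨z, rfl⟩ := (Module.AEval'.of φ).surjective y
    rw [← Module.AEval.of_aeval_smul]
    simp [h0]
  let Φ : (ι →₀ (k[X] ⧸ Ideal.span {(X : k[X]) ^ p})) →ₗ[k[X]] Module.AEval' φ :=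
    Finsupp.lsum ℕ fun i => Submodule.liftQ (Ideal.span {(X : k[X]) ^ p})
      (LinearMap.toSpanSingleton k[X] _ (Module.AEval'.of φ (m i.down)))
      ((Ideal.span_singleton_le_iff_mem _).2 (hX _))
  have hΦm : ∀ i, Module.AEval'.of φ (m i) ∈ LinearMap.range Φ := by
    intro i
    refine ⟨Finsupp.single ⟨i⟩ (Ideal.Quotient.mk _ 1), ?_⟩
    rw [Finsupp.lsum_single]
    exact one_smul k[X] _
  let N : Submodule k V :=
    ((LinearMap.range Φ).restrictScalars k).comap (Module.AEval'.of φ).toLinearMap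
  have hN : ∀ x ∈ N, φ x ∈ N := by
    intro x hx
    change Module.AEval'.of φ (φ x) ∈ LinearMap.range Φ
    rw [← Module.AEval'.X_smul_of]
    exact Submodule.smul_mem _ _ hx
  have hsup : N ⊔ LinearMap.range φ = ⊤ := by
    rw [eq_top_iff]
    intro x _
    have hx : Submodule.Quotient.mk x ∈ Submodule.map (LinearMap.range φ).mkQ N := by
      have : ∀ y : V ⧸ LinearMap.range φ, y ∈ Submodule.map (LinearMap.range φ).mkQ N := by
        intro y
        rw [← b.sum_repr y]
        refine Submodule.sum_mem _ fun i _ => Submodule.smul_mem _ _ ⟨m i, hΦm i, hm i⟩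
      exact this _
    obtain ⟨y, hy, hyx⟩ := hx
    have : x - y ∈ LinearMap.range φ := (Submodule.Quotient.eq _).1 hyx.symm
    rw [← add_sub_cancel y x]
    exact Submodule.add_mem_sup hy this
  -- Nakayama by iteration: `V = N + φV` gives `V = N + φ^j V`, and `φ^p = 0`.
  have hpow : ∀ j x, ∃ y ∈ N, ∃ z, x = y + (φ ^ j) z := by
    intro j
    induction j with
    | zero => exact fun x => ⟨0, N.zero_mem, x, by simp⟩
    | succ j ih =>
      intro x
      obtain ⟨y, hy, z, rfl⟩ := ih x
      obtain ⟨y', hy', _, ⟨z', rfl⟩, hz⟩ := Submodule.mem_sup.1 (hsup ▸ Submodule.mem_top (x := z))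
      refine ⟨y + (φ ^ j) y', N.add_mem hy ?_, z', ?_⟩
      · clear hz ih
        induction j with
        | zero => simpa using hy'
        | succ j ih => rw [pow_succ']; exact hN _ ih
      · rw [← hz, map_add, pow_succ, Module.End.mul_apply, add_assoc]
  have hsurj : Function.Surjective Φ := by
    intro y
    obtain ⟨x, rfl⟩ := (Module.AEval'.of φ).surjective y
    obtain ⟨y, hy, z, hx⟩ := hpow p x
    rw [h0, LinearMap.zero_apply, add_zero] at hx
    rw [hx]
    exact hy
  have hfin : Module.Finite k (k[X] ⧸ Ideal.span {(X : k[X]) ^ p}) :=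
    (AdjoinRoot.powerBasis' (monic_X_pow (R := k) p)).finite
  have hfr : Module.finrank k (ι →₀ (k[X] ⧸ Ideal.span {(X : k[X]) ^ p})) =
      Module.finrank k (Module.AEval' φ) := by
    have h1 := Submodule.finrank_quotient_add_finrank (LinearMap.range φ)
    have h2 := LinearMap.finrank_range_add_finrank_ker φ
    rw [(Finsupp.linearEquivFunOnFinite k _ ι).finrank_eq, Module.finrank_pi_fintype,
      Finset.sum_const, finrank_quotient_X_pow, smul_eq_mul, Finset.card_univ,
      ← (Module.AEval'.of φ).finrank_eq, h, Fintype.card_ulift, Fintype.card_fin, mul_comm]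
    congr 1
    omega
  have : Module.Finite k (Module.AEval' φ) := Module.Finite.equiv (Module.AEval'.of φ)
  have hinj : Function.Injective Φ :=
    (LinearMap.injective_iff_surjective_of_finrank_eq_finrank hfr
      (f := Φ.restrictScalars k)).2 hsurj
  exact ⟨ι, ⟨(LinearEquiv.ofBijective Φ ⟨hinj, hsurj⟩).symm⟩⟩

end JordanRank

/-! ## Divided power relations -/

section DividedPowers

/-- `(pm choose m) = p · (pm - 1 choose m - 1)`. -/
theorem Nat.Prime.dvd_choose_mul {p : ℕ} (hp : p.Prime) {m : ℕ} (hm : 0 < m) :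
    p ∣ (p * m).choose m := by
  obtain ⟨m, rfl⟩ : ∃ l, m = l + 1 := ⟨m - 1, by omega⟩
  obtain ⟨N, hN⟩ : ∃ N, p * (m + 1) = N + 1 :=
    ⟨p * (m + 1) - 1, (Nat.sub_add_cancel (Nat.mul_pos hp.pos hm)).symm⟩
  have h := Nat.add_one_mul_choose_eq N m
  rw [← hN, mul_right_comm] at h
  exact ⟨N.choose m, (Nat.eq_of_mul_eq_mul_right hm h).symm⟩

variable {k : Type*} [Field k] (p : ℕ) [hp : Fact p.Prime] [CharP k p] {A : Type*} [CommRing A]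
  [Algebra k A] {v : ℕ → A} {r : ℕ}

/-- `v m ^ (p-1)` is a scalar multiple of `v ((p-1)m)`, and the last multiplication by `v m`
contributes `(pm choose m)`, which is zero in `k`. -/
theorem dividedPower_pow_char (hv : ∀ i j, v i * v j = ((i + j).choose i : k) • v (i + j)) {m : ℕ}
    (hm : 0 < m) : v m ^ p = 0 := by
  have h : ∀ j : ℕ, ∃ c : k, v m ^ (j + 1) = c • v ((j + 1) * m) := by
    intro j
    induction j with
    | zero => exact ⟨1, by simp⟩
    | succ j ih =>
      obtain ⟨c, hc⟩ := ih
      refine ⟨c * (((j + 1) * m + m).choose ((j + 1) * m) : ℕ), ?_⟩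
      rw [pow_succ, hc, smul_mul_assoc, hv, smul_smul, ← add_one_mul (j + 1)]
  obtain ⟨l, hl⟩ : ∃ l, p = l + 1 + 1 := ⟨p - 2, by have := hp.out.two_le; omega⟩
  obtain ⟨c, hc⟩ := h l
  have h0 : (((l + 1) * m + m).choose ((l + 1) * m) : k) = 0 := by
    rw [CharP.cast_eq_zero_iff k p, Nat.choose_symm_add, ← add_one_mul, ← hl]
    exact hp.out.dvd_choose_mul hm
  rw [hl, pow_succ, hc, smul_mul_assoc, hv, h0, zero_smul, smul_zero]

theorem dividedPower_sum_pow_char (hv : ∀ i j, v i * v j = ((i + j).choose i : k) • v (i + j))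
    {ι : Type*} (S : Finset ι) (c : ι → k) (e : ι → ℕ) (h0 : ∀ i, e i = 0 → c i = 0) :
    (∑ i ∈ S, c i • v (e i)) ^ p = 0 := by
  rcases subsingleton_or_nontrivial A with h | h
  · exact Subsingleton.elim _ _
  · have : CharP A p := charP_of_injective_algebraMap (algebraMap k A).injective p
    rw [sum_pow_char]
    refine Finset.sum_eq_zero fun i _ => ?_
    rw [_root_.smul_pow]
    rcases Nat.eq_zero_or_pos (e i) with hi | hi
    · rw [h0 i hi, zero_pow hp.out.ne_zero, zero_smul]
    · rw [dividedPower_pow_char p hv hi, smul_zero]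

/-- Unless `n` is a power of `p`, some `(n choose i)` with `0 < i < n` is prime to `p` and can be
inverted. -/
theorem dividedPower_eq_smul_mul (hv : ∀ i j, v i * v j = ((i + j).choose i : k) • v (i + j))
    {n : ℕ} (hn : 0 < n) (hnp : ∀ s, n ≠ p ^ s) :
    ∃ (i : ℕ) (c : k), 0 < i ∧ i < n ∧ v n = c • (v i * v (n - i)) := by
  by_contra! hcon
  obtain ⟨s, hs⟩ := eq_primePow_of_choose p n hn.ne' fun i hi hin => by
    by_contra hd
    refine hcon i ((n.choose i : k)⁻¹) hi hin ?_
    rw [hv, Nat.add_sub_cancel' hin.le, smul_smul, inv_mul_cancel₀, one_smul]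
    rwa [Ne, CharP.cast_eq_zero_iff k p]
  exact hnp s hs

theorem dividedPower_mem_span (hv : ∀ i j, v i * v j = ((i + j).choose i : k) • v (i + j))
    (hr : ∀ n, p ^ r ≤ n → v n = 0) {n : ℕ} (hn : 0 < n) :
    v n ∈ Ideal.span (Set.range fun s : Fin r => v (p ^ (s : ℕ))) := by
  induction n using Nat.strong_induction_on with
  | _ n ih =>
    by_cases hnp : ∀ s, n ≠ p ^ s
    · obtain ⟨i, c, hi, hin, h⟩ := dividedPower_eq_smul_mul p hv hn hnp
      rw [h, Algebra.smul_def]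
      exact Ideal.mul_mem_left _ _ (Ideal.mul_mem_right _ _ (ih i hin hi))
    · push Not at hnp
      obtain ⟨s, rfl⟩ := hnp
      by_cases hs : s < r
      · exact Ideal.subset_span ⟨⟨s, hs⟩, rfl⟩
      · rw [hr _ (Nat.pow_le_pow_right hp.out.pos (not_lt.1 hs))]
        exact Ideal.zero_mem _

/-- Such a `v n` is a multiple of two `v`'s of positive index: one factor is nilpotent, the other
lies in the ideal. -/
theorem dividedPower_mem_nilradical_mul_span
    (hv : ∀ i j, v i * v j = ((i + j).choose i : k) • v (i + j))
    (hr : ∀ n, p ^ r ≤ n → v n = 0) {n : ℕ} (hn : 0 < n) (hnp : ∀ s, n ≠ p ^ s) :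
    v n ∈ nilradical A • Ideal.span (Set.range fun s : Fin r => v (p ^ (s : ℕ))) := by
  obtain ⟨i, c, hi, hin, h⟩ := dividedPower_eq_smul_mul p hv hn hnp
  rw [h, ← smul_mul_assoc, Algebra.smul_def c (v i)]
  exact Submodule.smul_mem_smul
    (Ideal.mul_mem_left _ _ (mem_nilradical.2 (⟨p, dividedPower_pow_char p hv hi⟩)))
    (dividedPower_mem_span p hv hr (by omega))

/-- Modulo the product of the nilradical and the ideal generated by the `v_(p^s)`, a linear
combination of divided powers without constant term is equal to its part in degrees `p^s`. -/
theorem exists_dividedPower_sum_eq (hv : ∀ i j, v i * v j = ((i + j).choose i : k) • v (i + j))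
    (hr : ∀ n, p ^ r ≤ n → v n = 0) (c : ℕ → k) (h0 : c 0 = 0) :
    ∃ γ : Fin r → A, (∀ s, IsNilpotent (γ s)) ∧ ∑ n ∈ Finset.range (p ^ r), c n • v n =
      ∑ s : Fin r, c (p ^ (s : ℕ)) • v (p ^ (s : ℕ)) + ∑ s, γ s * v (p ^ (s : ℕ)) := by
  let S : Finset ℕ := Finset.univ.image fun s : Fin r => p ^ (s : ℕ)
  have hS : S ⊆ Finset.range (p ^ r) := by
    intro n hn
    obtain ⟨s, -, rfl⟩ := Finset.mem_image.1 hn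
    exact Finset.mem_range.2 (Nat.pow_lt_pow_right hp.out.one_lt s.2)
  have hmem : ∑ n ∈ Finset.range (p ^ r) \ S, c n • v n ∈
      nilradical A • Ideal.span (Set.range fun s : Fin r => v (p ^ (s : ℕ))) := by
    refine Submodule.sum_mem _ fun n hn => ?_
    rw [Finset.mem_sdiff, Finset.mem_range] at hn
    rcases Nat.eq_zero_or_pos n with rfl | hn0
    · rw [h0, zero_smul]
      exact Submodule.zero_mem _
    · rw [Algebra.smul_def (c n) (v n)]
      refine Ideal.mul_mem_left _ _ (dividedPower_mem_nilradical_mul_span p hv hr hn0 ?_)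
      rintro s rfl
      exact hn.2 (Finset.mem_image.2
        ⟨⟨s, (Nat.pow_lt_pow_iff_right hp.out.one_lt).1 hn.1⟩, Finset.mem_univ _, rfl⟩)
  obtain ⟨γ, hγ, hsum⟩ := (Submodule.mem_ideal_smul_span_iff_exists_sum _ _ _).1 hmem
  refine ⟨γ, fun s => mem_nilradical.1 (hγ s), ?_⟩
  rw [← Finset.sum_sdiff hS, ← hsum, Finsupp.sum_fintype _ _ (by simp), Finset.sum_image, add_comm]
  · rfl
  · intro s _ t _ hst
    exact Fin.ext (Nat.pow_right_injective hp.out.two_le hst)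

end DividedPowers

/-! ## The algebra acting on a rational module -/

section RationalModule

variable {k : Type u} [Field k] {M : Type v} [AddCommGroup M] [Module k M]

/-- Coassociativity: functionals act through the convolution product. -/
theorem RightComodule.act_mul {C : Type u} [AddCommGroup C] [Module k C] [Coalgebra k C]
    (ρ : RightComodule k C M) (φ ψ : C →ₗ[k] k) :
    ρ.act φ * ρ.act ψ = ρ.act ((TensorProduct.lid k k).toLinearMap ∘ₗ TensorProduct.map φ ψ ∘ₗ
      Coalgebra.comul) := by
  let F : M ⊗[k] (C ⊗[k] C) →ₗ[k] M := (TensorProduct.rid k M).toLinearMap ∘ₗ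
    ((TensorProduct.lid k k).toLinearMap ∘ₗ TensorProduct.map φ ψ).lTensor M
  have h1 : ∀ (w : M ⊗[k] C) (f : C), F (TensorProduct.assoc k M C C (w ⊗ₜ f)) =
      ψ f • TensorProduct.rid k M (φ.lTensor M w) := by
    intro w f
    induction w with
    | zero => simp
    | add x y hx hy =>
      rw [TensorProduct.add_tmul, map_add, map_add, hx, hy, map_add, map_add, smul_add]
    | tmul m g => simp [F, smul_smul, mul_comm]
  have h2 : ∀ z : M ⊗[k] C, ρ.act φ (TensorProduct.rid k M (ψ.lTensor M z)) =
      F (TensorProduct.assoc k M C C (ρ.coact.rTensor C z)) := by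
    intro z
    induction z with
    | zero => simp
    | add x y hx hy => simp only [map_add, hx, hy]
    | tmul m f =>
      rw [LinearMap.rTensor_tmul, h1, LinearMap.lTensor_tmul, TensorProduct.rid_tmul, map_smul]
      rfl
  refine LinearMap.ext fun m => ?_
  have h3 := DFunLike.congr_fun ρ.coassoc m
  have h4 := h2 (ρ.coact m)
  change ρ.act φ (TensorProduct.rid k M (ψ.lTensor M (ρ.coact m))) = _
  rw [h4]
  refine (congrArg F h3).trans ?_
  simp only [F, RightComodule.act, LinearMap.comp_apply, LinearEquiv.coe_coe]
  rw [← LinearMap.comp_apply (LinearMap.lTensor M _) (LinearMap.lTensor M _),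
    ← LinearMap.lTensor_comp, LinearMap.comp_assoc]

namespace RationalGaModule

theorem act_lcoeff_mul (ρ : RationalGaModule k M) (i j : ℕ) :
    ρ.act (lcoeff k i) * ρ.act (lcoeff k j) =
      ((i + j).choose i : k) • ρ.act (lcoeff k (i + j)) := by
  have h : (TensorProduct.lid k k).toLinearMap ∘ₗ TensorProduct.map (lcoeff k i) (lcoeff k j) ∘ₗ
      Coalgebra.comul = ((i + j).choose i : k) • lcoeff k (i + j) := by
    refine LinearMap.ext fun f => ?_
    exact coeffTwo_comul i j f
  rw [RightComodule.act_mul, h]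
  simp only [RightComodule.act, LinearMap.lTensor_smul, LinearMap.smul_comp, LinearMap.comp_smul]

theorem HasDegreeLT.act_eq {ρ : RationalGaModule k M} {N : ℕ} (h : ρ.HasDegreeLT N)
    (φ : k[X] →ₗ[k] k) :
    ρ.act φ = ∑ n ∈ Finset.range N, φ (X ^ n) • ρ.act (lcoeff k n) := by
  have key : ∀ w : M ⊗[k] degreeLT k N,
      TensorProduct.rid k M (φ.lTensor M ((degreeLT k N).subtype.lTensor M w)) =
        ∑ n ∈ Finset.range N, φ (X ^ n) •
          TensorProduct.rid k M ((lcoeff k n).lTensor M ((degreeLT k N).subtype.lTensor M w)) := by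
    intro w
    induction w with
    | zero => simp
    | add x y hx hy => simp only [map_add, hx, hy, smul_add, Finset.sum_add_distrib]
    | tmul m f =>
      have hf : (f : k[X]) = ∑ n ∈ Finset.range N, (f : k[X]).coeff n • X ^ n := by
        ext n
        simp only [finsetSum_coeff, coeff_smul, coeff_X_pow, smul_eq_mul, mul_ite, mul_one,
          mul_zero, Finset.sum_ite_eq, Finset.mem_range]
        split_ifs with hn
        · rfl
        · exact (degree_lt_iff_coeff_zero _ _).1 (mem_degreeLT.1 f.2) n (not_lt.1 hn)
      have hφ : φ f = ∑ n ∈ Finset.range N, φ (X ^ n) * (f : k[X]).coeff n := by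
        conv_lhs => rw [hf, map_sum]
        simp only [map_smul, smul_eq_mul, mul_comm]
      simp only [LinearMap.lTensor_tmul, TensorProduct.rid_tmul, Submodule.subtype_apply,
        lcoeff_apply, hφ, smul_smul, Finset.sum_smul]
  refine LinearMap.ext fun m => ?_
  obtain ⟨w, hw⟩ := h ⟨m, rfl⟩
  simp only [LinearMap.sum_apply, LinearMap.smul_apply, RightComodule.act, LinearMap.comp_apply,
    ← hw]
  exact key w

theorem HasDegreeLT.act_lcoeff_eq_zero {ρ : RationalGaModule k M} {N : ℕ} (h : ρ.HasDegreeLT N)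
    {n : ℕ} (hn : N ≤ n) : ρ.act (lcoeff k n) = 0 := by
  rw [h.act_eq]
  refine Finset.sum_eq_zero fun i hi => ?_
  have := Finset.mem_range.1 hi
  rw [lcoeff_apply, coeff_X_pow, if_neg (by omega), zero_smul]

/-- The operators commute, so the subalgebra they generate is a commutative ring with a nilradical
and ideals. Injectivity of `θ` carries relations between operators back to it. -/
theorem exists_algHom (ρ : RationalGaModule k M) :
    ∃ (A : Type v) (_ : CommRing A) (_ : Algebra k A) (θ : A →ₐ[k] Module.End k M) (v : ℕ → A),
      Function.Injective θ ∧ ∀ n, θ (v n) = ρ.act (lcoeff k n) := by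
  let s : Set (Module.End k M) := Set.range fun n => ρ.act (lcoeff k n)
  have hs : ∀ x ∈ s, ∀ y ∈ s, x * y = y * x := by
    rintro _ ⟨i, rfl⟩ _ ⟨j, rfl⟩
    dsimp only
    rw [act_lcoeff_mul, act_lcoeff_mul, add_comm j i, Nat.choose_symm_add]
  have hcomm := Algebra.isMulCommutative_adjoin k hs
  let inst : CommRing (Algebra.adjoin k s) :=
    { (inferInstance : Ring (Algebra.adjoin k s)) with
      mul_comm := fun x y => hcomm.is_comm.comm x y }
  exact ⟨Algebra.adjoin k s, inst, (inferInstance : Algebra k (Algebra.adjoin k s)),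
    (Algebra.adjoin k s).val, fun n => ⟨_, Algebra.subset_adjoin ⟨n, rfl⟩⟩,
    Subtype.val_injective, fun n => rfl⟩

end RationalGaModule

end RationalModule

/-! ## Maximal Jordan types -/

section MaximalJordanType

/-! ### Nilpotent perturbations of linear combinations. -/

section Perturbation

variable {k : Type u} [Field k] [Infinite k] {p : ℕ} [hp : Fact p.Prime] [CharP k p] {M : Type v}
  [AddCommGroup M] [Module k M] [FiniteDimensional k M] {A : Type*} [CommRing A] [Algebra k A]
  (θ : A →ₐ[k] Module.End k M) {ι : Type*} [Fintype ι] {β γ : ι → A}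

theorem exists_powRank_combination_add_le (p : ℕ) [Fact p.Prime] [CharP k p]
    (hγ : ∀ i, IsNilpotent (γ i)) (c : ι → k) (j : ℕ) :
    ∃ c' : ι → k, powRank (θ (∑ i, c i • β i + ∑ i, γ i * β i)) j ≤
      powRank (θ (∑ i, c' i • β i)) j := by
  obtain ⟨t, ht⟩ := exists_powRank_add_sum_le θ p (∑ i, c i • β i) β γ hγ Finset.univ j
  refine ⟨c + t, ht.trans_eq ?_⟩
  simp only [Pi.add_apply, add_smul, Finset.sum_add_distrib]

theorem powRank_combination_add_eq (p : ℕ) [Fact p.Prime] [CharP k p]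
    (hγ : ∀ i, IsNilpotent (γ i)) (c : ι → k) (j : ℕ)
    (h : ∀ c' : ι → k, powRank (θ (∑ i, c' i • β i)) j ≤ powRank (θ (∑ i, c i • β i)) j) :
    powRank (θ (∑ i, c i • β i + ∑ i, γ i * β i)) j = powRank (θ (∑ i, c i • β i)) j := by
  refine powRank_add_sum_eq θ p _ β γ hγ Finset.univ j fun t => ?_
  have := h (c + t)
  simpa only [Pi.add_apply, add_smul, Finset.sum_add_distrib] using this

/-- Here the perturbed element is the maximal one, and the perturbation is undone by adding its
negative. -/
theorem powRank_combination_eq (p : ℕ) [Fact p.Prime] [CharP k p]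
    (hγ : ∀ i, IsNilpotent (γ i)) (c : ι → k) (j : ℕ)
    (h : ∀ c' : ι → k, powRank (θ (∑ i, c' i • β i)) j ≤
      powRank (θ (∑ i, c i • β i + ∑ i, γ i * β i)) j) :
    powRank (θ (∑ i, c i • β i)) j = powRank (θ (∑ i, c i • β i + ∑ i, γ i * β i)) j := by
  have h1 := powRank_add_sum_eq θ p (∑ i, c i • β i + ∑ i, γ i * β i) β (fun i => -γ i)
    (fun i => (hγ i).neg) Finset.univ j fun t => ?_
  · rw [← h1]
    simp only [neg_mul, Finset.sum_neg_distrib, add_neg_cancel_right]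
  -- The competitors are themselves perturbed combinations; each is first dominated by an
  -- unperturbed one.
  · obtain ⟨c', hc'⟩ := exists_powRank_combination_add_le (β := β) θ p hγ (c + t) j
    refine le_trans (le_of_eq ?_) (hc'.trans (h c'))
    simp only [Pi.add_apply, add_smul, Finset.sum_add_distrib]
    rw [add_right_comm]

/-- A `p`-nilpotent operator has kernel of dimension at least `dim M / p`, with equality exactly
when `M` is free. So freeness makes the rank of `θ x` maximal among all `x + ∑ c_i β_i`, and the
perturbation preserves that rank. -/
theorem IsFreeTruncated.perturb {p : ℕ} [Fact p.Prime] [CharP k p] {x : A}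
    (hγ : ∀ i, IsNilpotent (γ i)) (hx : ∀ c : ι → k, (x + ∑ i, c i • β i) ^ p = 0)
    (hx' : (x + ∑ i, γ i * β i) ^ p = 0)
    (h : IsFreeTruncated p (θ x)) : IsFreeTruncated p (θ (x + ∑ i, γ i * β i)) := by
  have hp0 : 0 < p := (Fact.out : p.Prime).pos
  have hfree := h.finrank_eq hp0
  have hker : ∀ φ : Module.End k M,
      powRank φ 1 + Module.finrank k (LinearMap.ker φ) = Module.finrank k M := fun φ => by
    rw [powRank, pow_one, LinearMap.finrank_range_add_finrank_ker]
  have h1 := powRank_add_sum_eq θ p x β γ hγ Finset.univ 1 fun c => ?_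
  · refine isFreeTruncated_of_finrank_eq (by rw [← map_pow, hx', map_zero]) ?_
    have h2 := hker (θ x)
    have h3 := hker (θ (x + ∑ i, γ i * β i))
    rw [hfree]
    congr 1
    omega
  · have h2 := hker (θ x)
    have h3 := hker (θ (x + ∑ i, c i • β i))
    have h4 := finrank_le_mul_finrank_ker (f := θ (x + ∑ i, c i • β i)) (N := p)
      (by rw [← map_pow, hx, map_zero])
    rw [hfree] at h4
    have h5 := Nat.le_of_mul_le_mul_left h4 hp0
    omega

end Perturbation

/-! ### The operators attached to one-parameter subgroups. -/

theorem frobCoeff_frobKerT_pow {k : Type u} [Field k] {p : ℕ} [hp : Fact p.Prime] {R : ℕ}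
    (hR : 0 < R) (n : ℕ) :
    frobCoeff p R (p ^ (R - 1)) (frobKerT k p R ^ n) = if n = p ^ (R - 1) then 1 else 0 := by
  rw [frobKerT, ← AdjoinRoot.mk_X, ← map_pow,
    frobCoeff_mk _ _ _ (Nat.pow_lt_pow_right hp.out.one_lt (by omega)), coeff_X_pow]
  simp only [eq_comm]

namespace RationalGaModule

variable {k : Type u} [Field k] {p : ℕ} [hp : Fact p.Prime] [CharP k p] {M : Type v}
  [AddCommGroup M] [Module k M] (ρ : RationalGaModule k M) {r : ℕ}

/-- The functional `μ_*(u_{R-1})` for `μ = σ_b`. -/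
noncomputable def infFunctional (p : ℕ) [Fact p.Prime] [CharP k p] {R : ℕ} (b : Fin R → k) :
    k[X] →ₗ[k] k :=
  frobCoeff p R (p ^ (R - 1)) ∘ₗ (infSigma p b).toCoalgHom.toLinearMap

theorem infFunctional_X_pow {R : ℕ} (b : Fin R → k) (n : ℕ) :
    infFunctional p b (X ^ n) = frobCoeff p R (p ^ (R - 1))
      ((∑ s : Fin R, b s • frobKerT k p R ^ p ^ (s : ℕ)) ^ n) := by
  change frobCoeff p R (p ^ (R - 1)) (infSigma p b (X ^ n)) = _
  rw [map_pow, infSigma, primitiveHom_X]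

theorem infFunctional_one {R : ℕ} (hR : 0 < R) (b : Fin R → k) :
    infFunctional p b (X ^ 0) = 0 := by
  have h := frobCoeff_frobKerT_pow (k := k) (p := p) hR 0
  rw [infFunctional_X_pow, pow_zero, ← pow_zero (frobKerT k p R), h,
    if_neg (pow_pos hp.out.pos _).ne]

/-- By additivity of Frobenius, `(∑ b_s T^(p^s))^(p^j) = ∑ b_s^(p^j) T^(p^(s+j))`, and the exponent
`p^(R-1)` occurs for `s = R - 1 - j`. This is the origin of the reversal in `λ_r`. -/
theorem infFunctional_X_pow_pow {R : ℕ} (b : Fin R → k) (j : ℕ) (hj : j < R) :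
    infFunctional p b (X ^ p ^ j) = b ⟨R - 1 - j, by omega⟩ ^ p ^ j := by
  rw [infFunctional_X_pow]
  have hsum : (∑ s : Fin R, b s • frobKerT k p R ^ p ^ (s : ℕ)) ^ p ^ j =
      ∑ s : Fin R, b s ^ p ^ j • frobKerT k p R ^ p ^ ((s : ℕ) + j) := by
    generalize (Finset.univ : Finset (Fin R)) = S
    classical
    induction S using Finset.induction_on with
    | empty => simp [hp.out.ne_zero]
    | insert a S ha ih =>
      rw [Finset.sum_insert ha, Finset.sum_insert ha, add_pow_primePow (k := k), ih,
        _root_.smul_pow, ← pow_mul, ← pow_add]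
  rw [hsum, map_sum, Finset.sum_eq_single ⟨R - 1 - j, by omega⟩]
  · rw [map_smul, frobCoeff_frobKerT_pow (by omega), if_pos, smul_eq_mul, mul_one]
    congr 1
    simp only
    omega
  · intro s _ hs
    rw [map_smul, frobCoeff_frobKerT_pow (by omega), if_neg, smul_zero]
    intro h
    have := Nat.pow_right_injective hp.out.two_le h
    exact hs (Fin.ext (by simp only; omega))
  · simp

theorem action_sigma_eq (hdeg : ρ.HasDegreeLT (p ^ r)) (a : ℕ →₀ k) :
    ρ.action p (sigma p a) =
      ∑ s : Fin r, a s ^ p ^ (s : ℕ) • ρ.act (lcoeff k (p ^ (s : ℕ))) := by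
  rw [action_sigma]
  have h0 : ∀ s, r ≤ s → ρ.act (lcoeff k (p ^ s)) = 0 := fun s hs =>
    hdeg.act_lcoeff_eq_zero (Nat.pow_le_pow_right hp.out.pos hs)
  rw [Fin.sum_univ_eq_sum_range (fun s => a s ^ p ^ s • ρ.act (lcoeff k (p ^ s))),
    Finsupp.sum_of_support_subset a (s := a.support ∪ Finset.range r) Finset.subset_union_left]
  · symm
    refine Finset.sum_subset Finset.subset_union_right fun s _ hs => ?_
    rw [h0 s (by simpa using hs), smul_zero]
  · intro s _
    rw [zero_pow (pow_pos hp.out.pos _).ne', zero_smul]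

/-- The action of a rational module of degree `< p^r` at infinitesimal 1-parameter subgroups is
computed in a commutative algebra: up to nilpotent multiples of the `u_s`, it is given by a linear
combination of the `u_s`. -/
theorem exists_model (hdeg : ρ.HasDegreeLT (p ^ r)) :
    ∃ (A : Type v) (_ : CommRing A) (_ : Algebra k A) (θ : A →ₐ[k] Module.End k M)
      (β : Fin r → A), (∀ s, θ (β s) = ρ.act (lcoeff k (p ^ (s : ℕ)))) ∧
      (∀ c : Fin r → k, (∑ s, c s • β s) ^ p = 0) ∧
      ∀ (R : ℕ) (hR : r ≤ R) (b : Fin R → k), 0 < R → ∃ γ : Fin r → A, (∀ s, IsNilpotent (γ s)) ∧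
        (∑ s : Fin r, b ⟨R - 1 - s, by omega⟩ ^ p ^ (s : ℕ) • β s + ∑ s, γ s * β s) ^ p = 0 ∧
        ρ.infAction (infSigma p b) =
          θ (∑ s : Fin r, b ⟨R - 1 - s, by omega⟩ ^ p ^ (s : ℕ) • β s + ∑ s, γ s * β s) := by
  obtain ⟨A, _, _, θ, v, hθ, hv⟩ := ρ.exists_algHom
  have hmul : ∀ i j, v i * v j = ((i + j).choose i : k) • v (i + j) := by
    intro i j
    apply hθ
    rw [map_mul, map_smul, hv, hv, hv, act_lcoeff_mul]
  have hzero : ∀ n, p ^ r ≤ n → v n = 0 := by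
    intro n hn
    apply hθ
    rw [hv, hdeg.act_lcoeff_eq_zero hn, map_zero]
  refine ⟨A, _, _, θ, fun s => v (p ^ (s : ℕ)), fun s => hv _, fun c => ?_, fun R hR b hR0 => ?_⟩
  · exact dividedPower_sum_pow_char p hmul Finset.univ c (fun s : Fin r => p ^ (s : ℕ))
      fun s hs => absurd hs (pow_pos hp.out.pos _).ne'
  · have h0 := infFunctional_one (p := p) hR0 b
    obtain ⟨γ, hγ, hsum⟩ := exists_dividedPower_sum_eq p hmul hzero
      (fun n => infFunctional p b (X ^ n)) h0
    have hlin : ∑ s : Fin r, infFunctional p b (X ^ p ^ (s : ℕ)) • v (p ^ (s : ℕ)) =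
        ∑ s : Fin r, b ⟨R - 1 - s, by omega⟩ ^ p ^ (s : ℕ) • v (p ^ (s : ℕ)) :=
      Finset.sum_congr rfl fun s _ => by rw [infFunctional_X_pow_pow b s (by omega)]
    rw [hlin] at hsum
    refine ⟨γ, hγ, ?_, ?_⟩
    · rw [← hsum]
      exact dividedPower_sum_pow_char p hmul _ _ id fun i hi => by rw [show i = 0 from hi]; exact h0
    · rw [← hsum, map_sum]
      refine (hdeg.act_eq (infFunctional p b)).trans (Finset.sum_congr rfl fun n _ => ?_)
      rw [map_smul, hv]

end RationalGaModule

end MaximalJordanType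

/-! ### The main theorem. -/

theorem mainTheorem5 {k : Type u} [Field k] [IsAlgClosed k] (p : ℕ) [Fact p.Prime] [CharP k p]
    {M : Type v} [AddCommGroup M] [Module k M] [FiniteDimensional k M]
    (ρ : RationalGaModule k M) (r : ℕ) (hr : 0 < r) (hdeg : ρ.HasDegreeLT (p ^ r)) :
    (∀ b : Fin r → k,
      (∀ μ : InfOneParam k p r,
        JordanLE p (ρ.infJT (infSigma p b)) (ρ.infJT μ) →
          JordanLE p (ρ.infJT μ) (ρ.infJT (infSigma p b))) →
      (∀ a : ℕ →₀ k, lambdaSeq r a = b → ρ.JT p (sigma p a) = ρ.infJT (infSigma p b)) ∧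
      ((∃ a : ℕ →₀ k, ρ.JT p (sigma p a) = ρ.infJT (infSigma p b)) ∧
        ∀ a : ℕ →₀ k, JordanLE p (ρ.JT p (sigma p a)) (ρ.infJT (infSigma p b)))) ∧
    ∀ c : ℕ, ρ.infSupport p (r + c) = qMap p r c ⁻¹' ρ.infSupport p r := by
  have hp0 : 0 < p := (Fact.out : p.Prime).pos
  have : Infinite k := IsAlgClosed.instInfinite
  obtain ⟨A, _, _, θ, β, hβ, hβp, hmodel⟩ := ρ.exists_model hdeg
  have hβp' : ∀ c : Fin r → k, θ (∑ s, c s • β s) ^ p = 0 := fun c => by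
    rw [← map_pow, hβp, map_zero]
  constructor
  · have hrev : ∀ s : Fin r, r - 1 - (r - 1 - (s : ℕ)) = s := fun s => by omega
    have haction : ∀ a : ℕ →₀ k, ρ.action p (sigma p a) =
        θ (∑ s : Fin r, a s ^ p ^ (s : ℕ) • β s) := by
      intro a
      rw [ρ.action_sigma_eq hdeg, map_sum]
      simp only [map_smul, hβ]
    -- One linear combination maximizes the ranks of all powers below `p`; higher powers vanish.
    obtain ⟨w, ⟨c₀, rfl⟩, hw⟩ := exists_forall_powRank_le p
      (LinearMap.range (θ.toLinearMap ∘ₗ Fintype.linearCombination k β)) p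
    have hmax : ∀ (c : Fin r → k) (j : ℕ),
        powRank (θ (∑ s, c s • β s)) j ≤ powRank (θ (∑ s, c₀ s • β s)) j := by
      intro c j
      rcases lt_or_ge j p with hj | hj
      · exact hw _ ⟨c, rfl⟩ j hj
      · rw [powRank, finrank_range_eq_zero (pow_eq_zero_of_le hj (hβp' c))]
        exact Nat.zero_le _
    choose γ hγ hγp hinf using fun b : Fin r → k => hmodel r le_rfl b hr
    have hinfp : ∀ b : Fin r → k, ρ.infAction (infSigma p b) ^ p = 0 := fun b => by
      rw [hinf, ← map_pow, hγp, map_zero]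
    have hle : ∀ (b : Fin r → k) (j : ℕ), powRank (ρ.infAction (infSigma p b)) j ≤
        powRank (θ (∑ s, c₀ s • β s)) j := by
      intro b j
      rw [hinf]
      obtain ⟨c', hc'⟩ := exists_powRank_combination_add_le (β := β) θ p (hγ b) _ j
      exact hc'.trans (hmax c' j)
    -- The linear part involves `p^s`-th powers of the coordinates, so prescribing it as `c₀`
    -- requires `p^s`-th roots.
    obtain ⟨b₀, hb₀⟩ : ∃ b₀ : Fin r → k,
        (fun s : Fin r => b₀ ⟨r - 1 - s, by omega⟩ ^ p ^ (s : ℕ)) = c₀ := by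
      choose root hroot using fun s : Fin r =>
        IsAlgClosed.exists_pow_nat_eq (c₀ s) (pow_pos hp0 (s : ℕ))
      refine ⟨fun s => root ⟨r - 1 - s, by omega⟩, funext fun s => ?_⟩
      simp only [hrev]
      exact hroot s
    have hb₀max : ∀ j, powRank (ρ.infAction (infSigma p b₀)) j =
        powRank (θ (∑ s, c₀ s • β s)) j := by
      intro j
      subst hb₀
      rw [hinf]
      exact powRank_combination_add_eq θ p (hγ b₀) _ j fun c' => hmax c' j
    intro b hb
    have hb' := hb (infSigma p b₀)
    simp only [RationalGaModule.infJT, jordanLE_jordanType_iff (hinfp _) (hinfp _)] at hb'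
    -- `σ_{b₀}` dominates every `σ_b`, so a type that is maximal only in the weak sense must
    -- coincide with that of `b₀`.
    have hbmax : ∀ j, powRank (ρ.infAction (infSigma p b)) j =
        powRank (θ (∑ s, c₀ s • β s)) j := fun j =>
      le_antisymm (hle b j) ((hb₀max j).symm.le.trans
        (hb' (fun i => (hle b i).trans (hb₀max i).symm.le) j))
    have heq : ∀ a : ℕ →₀ k, lambdaSeq r a = b →
        ρ.JT p (sigma p a) = ρ.infJT (infSigma p b) := by
      intro a hab
      have hab' : ∀ s : Fin r, b ⟨r - 1 - s, by omega⟩ = a s := fun s => by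
        rw [← hab, lambdaSeq]
        simp only [hrev]
      refine jordanType_eq_of_powRank_eq ⟨p, by rw [haction]; exact hβp' _⟩ ⟨p, hinfp b⟩ fun j => ?_
      rw [haction]
      have h := powRank_combination_eq (β := β) θ p (hγ b)
        (fun s : Fin r => b ⟨r - 1 - s, by omega⟩ ^ p ^ (s : ℕ)) j fun c' => ?_
      · rw [← hinf] at h
        simpa only [hab'] using h
      · rw [← hinf, hbmax]
        exact hmax c' j
    refine ⟨heq, ?_, fun a => ?_⟩
    · let a : ℕ →₀ k := Finsupp.onFinset (Finset.range r)
        (fun s => if h : s < r then b ⟨r - 1 - s, by omega⟩ else 0) fun s hs => by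
          by_contra h
          exact hs (dif_neg (by simpa using h))
      refine ⟨a, heq a (funext fun s => ?_)⟩
      change (if h : r - 1 - (s : ℕ) < r then b ⟨r - 1 - (r - 1 - s), by omega⟩ else 0) = b s
      rw [dif_pos (by omega)]
      simp only [hrev]
    · rw [RationalGaModule.JT, RationalGaModule.infJT, haction,
        jordanLE_jordanType_iff (hβp' _) (hinfp _)]
      intro j
      rw [hbmax]
      exact hmax _ j
  · intro c
    ext μ
    obtain ⟨b, rfl⟩ := (infOneParamEquiv k p (r + c)).surjective μ
    have hq : qMap p r c (infOneParamEquiv k p (r + c) b) =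
        infSigma p fun i : Fin r => b ⟨c + i, by omega⟩ := by
      rw [qMap, Equiv.symm_apply_apply]
    obtain ⟨γ₁, hγ₁, hp₁, h₁⟩ := hmodel (r + c) (Nat.le_add_right _ _) b (by omega)
    obtain ⟨γ₂, hγ₂, hp₂, h₂⟩ := hmodel r le_rfl (fun i : Fin r => b ⟨c + i, by omega⟩) hr
    -- The index shift in `q_{r+c,r}` makes both operators have the same linear part `x`; only their
    -- nilpotent errors differ.
    have hidx : ∀ s : Fin r, c + (r - 1 - (s : ℕ)) = r + c - 1 - s := fun s => by omega
    simp only [hidx] at hp₂ h₂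
    rw [Set.mem_preimage, hq]
    change ¬ IsFreeTruncated p (ρ.infAction (infSigma p b)) ↔ ¬ IsFreeTruncated p (ρ.infAction _)
    rw [h₁, h₂, not_iff_not]
    set x := ∑ s : Fin r, b ⟨r + c - 1 - s, by omega⟩ ^ p ^ (s : ℕ) • β s
    have hadd : ∀ y z : A, y ^ p = 0 → z ^ p = 0 → (y + z) ^ p = 0 := fun y z hy hz => by
      have := add_pow_primePow (k := k) p 1 y z
      rwa [pow_one, hy, hz, add_zero] at this
    have key : ∀ γ γ' : Fin r → A, (∀ s, IsNilpotent (γ s)) → (∀ s, IsNilpotent (γ' s)) →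
        (x + ∑ s, γ s * β s) ^ p = 0 → (x + ∑ s, γ' s * β s) ^ p = 0 →
        IsFreeTruncated p (θ (x + ∑ s, γ s * β s)) →
        IsFreeTruncated p (θ (x + ∑ s, γ' s * β s)) := by
      intro γ γ' hγ hγ' h h' hfree
      -- The difference of the errors is again of the form `∑ (nilpotent) * β s`, so freeness passes
      -- directly from one operator to the other, without any assertion about `x` itself.
      have hdiff : x + ∑ s, γ' s * β s = x + ∑ s, γ s * β s + ∑ s, (γ' s - γ s) * β s := by
        simp only [sub_mul, Finset.sum_sub_distrib]
        ring
      rw [hdiff] at h' ⊢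
      exact IsFreeTruncated.perturb θ
        (fun s => (Commute.all _ _).isNilpotent_sub (hγ' s) (hγ s))
        (fun c => hadd _ _ h (hβp c)) h' hfree
    exact ⟨key γ₁ γ₂ hγ₁ hγ₂ hp₁ hp₂, key γ₂ γ₁ hγ₂ hγ₁ hp₂ hp₁⟩
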